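/- Consider the $2\pi$-periodic Riccati equation $$u' = (\sin t-2)u^2+\eta-\cos t,\qquad \eta\in\mathbb R. \tag{1}$$ Throughout, $T=2\pi$ and "periodic" means $T$-periodic. Put $A(t)=\frac{\cos t}{2(\sin t-2)}$ and $$\gamma_\eta(t)=(\sin t-2)(\eta-\cos t)-A(t)^2+A'(t),$$ so that $x=(\sin t-2)u+A(t)$ transforms (1) into $x'=x^2+\gamma_\eta(t)$. Let $\overline\gamma_\eta=\frac1T\int_0^T\gamma_\eta(t)\,dt$ and $\widehat\gamma_\eta=\gamma_\eta-\overline\gamma_\eta$. For periodic $C^1$ functions $p$ and $q$, where $q$ has zero average, let $$\underline\mu_\eta(p)=-\max_{t\in[0,T]}\{p(t)^2+\widehat\gamma_\eta(t)-p'(t)\},\qquad \overline\mu_\eta(q)=\frac{\int_0^T e^{-2\int_0^t q(s)\,ds}\,(q(t)^2-\widehat\gamma_\eta(t))\,dt}{\int_0^T e^{-2\int_0^t q(s)\,ds}\,dt}.$$ A periodic solution of (1) is called hyperbolic (respectively double) if its value at $t=0$ is a zero of multiplicity one (respectively two) of the displacement map of (1), that is, of the Poincaré map at time $T$ minus the identity.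 Theorem. For every $\eta\in\mathbb R$ the maximum of $\underline\mu_\eta(p)$ over all periodic $C^1$ functions $p$ and the minimum of $\overline\mu_\eta(q)$ over all periodic $C^1$ functions $q$ with zero average exist and are equal. Denote the common value by $\mu^*(\eta)$, and define the discriminant $\Delta(\eta)=\mu^*(\eta)-\overline\gamma_\eta$. Then $\Delta$ has exactly one zero $\eta^*$ in $\mathbb R$, and $\eta^*\in\left(\frac{3-2\sqrt3}{24},1\right)$. Moreover $\Delta(\eta)<0$ for $\eta<\eta^*$ and $\Delta(\eta)>0$ for $\eta>\eta^*$. Equation (1) has no periodic solutions if $\eta<\eta^*$; it has exactly one periodic solution if $\eta=\eta^*$, and this solution is double; and it has exactly two periodic solutions if $\eta>\eta^*$, and both are hyperbolic. -/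

import Mathlib

noncomputable section

namespace Riccati

open Set Filter Topology

/-! ### Scalar `T`-periodic differential equations `x' = f (t, x)` -/

/-- `φ` is a (globally defined) `T`-periodic solution of `x' = f (t, x)`. -/
def IsPeriodicSolution (f : ℝ → ℝ → ℝ) (T : ℝ) (φ : ℝ → ℝ) : Prop :=
  (∀ t, HasDerivAt φ (f t (φ t)) t) ∧ Function.Periodic φ T

/-- `ψ` solves `x' = f (t, x)`, `x(0) = x₀` on the whole interval `[0, T]`. -/
def IsSolutionFrom (f : ℝ → ℝ → ℝ) (T x₀ : ℝ) (ψ : ℝ → ℝ) : Prop :=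
  ψ 0 = x₀ ∧ ∀ t ∈ Icc 0 T, HasDerivWithinAt ψ (f t (ψ t)) (Icc 0 T) t

open Classical in
/-- The displacement map `x₀ ↦ ψ(T) - x₀` (Poincaré map at time `T` minus the identity), where `ψ`
is the solution with `ψ(0) = x₀`, which is unique on `[0, T]` when `f` is continuous, and locally
Lipschitz in `x`. It has the value `0` by convention at the points `x₀` whose solution does not
reach time `T`; `HasMultiplicity` below only looks at it on open sets without such points. -/
def displacement (f : ℝ → ℝ → ℝ) (T : ℝ) (x₀ : ℝ) : ℝ :=
  if h : ∃ ψ, IsSolutionFrom f T x₀ ψ then h.choose T - x₀ else 0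

/-- The periodic solution `φ` has multiplicity `n`: the displacement map is defined in a
neighbourhood of `φ(0)`, and `φ(0)` is a zero of multiplicity `n` of it. -/
def HasMultiplicity (f : ℝ → ℝ → ℝ) (T : ℝ) (φ : ℝ → ℝ) (n : ℕ) : Prop :=
  (∀ᶠ x₀ in 𝓝 (φ 0), ∃ ψ, IsSolutionFrom f T x₀ ψ) ∧
  ContDiffAt ℝ n (displacement f T) (φ 0) ∧
  (∀ k < n, iteratedDeriv k (displacement f T) (φ 0) = 0) ∧
  iteratedDeriv n (displacement f T) (φ 0) ≠ 0

/-- A periodic solution is hyperbolic if it is a simple zero of the displacement map. -/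
def IsHyperbolic (f : ℝ → ℝ → ℝ) (T : ℝ) (φ : ℝ → ℝ) : Prop :=
  HasMultiplicity f T φ 1

/-- A periodic solution is double if it is a zero of multiplicity two of the displacement map. -/
def IsDouble (f : ℝ → ℝ → ℝ) (T : ℝ) (φ : ℝ → ℝ) : Prop :=
  HasMultiplicity f T φ 2

/-! ### The discriminant of `x' = x ^ 2 + γ (t)` -/

/-- The average of a `T`-periodic function. -/
def average (T : ℝ) (γ : ℝ → ℝ) : ℝ :=
  (1 / T) * ∫ t in (0 : ℝ)..T, γ t

/-- The mean-centered function `γ - average γ`. -/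
def centered (T : ℝ) (γ : ℝ → ℝ) (t : ℝ) : ℝ :=
  γ t - average T γ

/-- The space of `T`-periodic `C¹` functions. -/
def periodicC1 (T : ℝ) : Set (ℝ → ℝ) :=
  {p | ContDiff ℝ 1 p ∧ Function.Periodic p T}

/-- The space of `T`-periodic `C¹` functions with zero average. -/
def periodicC1Zero (T : ℝ) : Set (ℝ → ℝ) :=
  {p | p ∈ periodicC1 T ∧ average T p = 0}

/-- The functional `p ↦ - max_{[0, T]} (p ^ 2 + centered γ - p')`. -/
def lowerMu (T : ℝ) (γ p : ℝ → ℝ) : ℝ :=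
  - sSup ((fun t => p t ^ 2 + centered T γ t - deriv p t) '' Icc 0 T)

/-- The weight `exp (- 2 ∫₀ᵗ p)`. -/
def weight (p : ℝ → ℝ) (t : ℝ) : ℝ :=
  Real.exp (-2 * ∫ s in (0 : ℝ)..t, p s)

/-- The functional sending `p` to the mean value of `p ^ 2 - centered γ` on `[0, T]` with respect
to the weight `exp (- 2 ∫₀ᵗ p)`. -/
def upperMu (T : ℝ) (γ p : ℝ → ℝ) : ℝ :=
  (∫ t in (0 : ℝ)..T, weight p t)⁻¹ *
    ∫ t in (0 : ℝ)..T, weight p t * (p t ^ 2 - centered T γ t)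

/-- The number `γ*`, the maximum of `lowerMu` over the `T`-periodic `C¹` functions. -/
def gammaStar (T : ℝ) (γ : ℝ → ℝ) : ℝ :=
  sSup (lowerMu T γ '' periodicC1 T)

/-- The discriminant of `x' = x ^ 2 + γ (t)`. -/
def discriminant (T : ℝ) (γ : ℝ → ℝ) : ℝ :=
  gammaStar T γ - average T γ

/-! ### Reduction of `x' = a₂ x ^ 2 + a₁ x + a₀` to the form `y' = y ^ 2 + γ` -/

/-- The function `A = (a₁ + a₂' / a₂) / 2`; the reduction is `y = a₂ x + A`. -/
def shift (a₂ a₁ : ℝ → ℝ) (t : ℝ) : ℝ :=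
  (1 / 2) * (a₁ t + deriv a₂ t / a₂ t)

/-- The function `γ = a₂ a₀ - A ^ 2 + A'`. -/
def reducedGamma (a₂ a₁ a₀ : ℝ → ℝ) (t : ℝ) : ℝ :=
  a₂ t * a₀ t - shift a₂ a₁ t ^ 2 + deriv (shift a₂ a₁) t

/-! ### The family `u' = (sin t - 2) u ^ 2 + η - cos t` -/

/-- The right-hand side of the family. -/
def familyField (η : ℝ) (t u : ℝ) : ℝ :=
  (Real.sin t - 2) * u ^ 2 + η - Real.cos t

/-- The function `γ` of the family, for `a₂ = sin t - 2`, `a₁ = 0`, `a₀ = η - cos t`. -/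
def familyGamma (η : ℝ) : ℝ → ℝ :=
  reducedGamma (fun t => Real.sin t - 2) (fun _ => 0) (fun t => η - Real.cos t)

/-- The discriminant of the family, as a function of `η`. -/
def familyDiscriminant (η : ℝ) : ℝ :=
  discriminant (2 * Real.pi) (familyGamma η)

end Riccati

end

noncomputable section

namespace Riccati

open Set Filter Topology

/-! ### The truncated equation `x' = min |x| R ^ 2 + γ (t)` -/

/-! The substitution x = (sin t - 2)u + A turns (1) into x' = x² + γ_η, so the periodic solutions of
x' = x² + γ + m are studied as the level m varies. Call m a subsolution level if some periodic C¹
function p satisfies p' ≥ p² + γ + m. By `le_lowerMu_iff`, maximizing `lowerMu` means finding the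
greatest such level, up to the shift by the average of γ.

Below a subsolution level, p is a one-way curve for the flow, while the Poincaré map pushes upwards
far from the origin; so there are fixed points on both sides of p (`exists_two_isPeriodicSolution`).
Compactness yields a periodic solution φ at the supremum D of the levels. Its mean is zero:
otherwise the linearization along φ is invertible on periodic functions, and φ can be perturbed to a
subsolution of higher level (`exists_strict_subsolution`).

Everything else follows from this φ. Completing the square with weight exp(-2∫q) gives `upperMu` q =
D + average γ + weighted mean of (q - φ)² (`upperMu_eq`), so maximum and minimum agree and the
discriminant is D. A periodic solution of mean zero is the only one, and two distinct periodic
solutions have opposite means, which excludes a third. Near a periodic solution the displacement map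
of a Riccati equation is a Möbius map minus the identity (`isSolutionFrom_add`), and the mean of x
decides between multiplicity one and two.

For the family, γ_{η+h} = γ_η + h(sin t - 2) with -3 ≤ sin t - 2 ≤ -1, which makes Δ strictly
increasing and Lipschitz. An explicit subsolution gives Δ(1) > 0; at (3 - 2√3)/24 the average of γ
is zero and Δ < 0. -/

/-- The right-hand side of `x' = x ^ 2 + γ (t)`. -/
def normalField (γ : ℝ → ℝ) (t x : ℝ) : ℝ := x ^ 2 + γ t

/-- The bounded, globally Lipschitz truncation of `normalField γ`. -/
def truncField (R : ℝ) (γ : ℝ → ℝ) (t x : ℝ) : ℝ := min |x| R ^ 2 + γ t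

lemma truncField_le_normalField {R : ℝ} (hR : 0 ≤ R) (γ : ℝ → ℝ) (t x : ℝ) :
    truncField R γ t x ≤ normalField γ t x := by
  have h : min |x| R ^ 2 ≤ x ^ 2 := by
    rw [← sq_abs x]
    exact pow_le_pow_left₀ (le_min (abs_nonneg _) hR) (min_le_left _ _) 2
  unfold truncField normalField
  linarith

lemma truncField_eq_normalField {R x : ℝ} (hx : |x| ≤ R) (γ : ℝ → ℝ) (t : ℝ) :
    truncField R γ t x = normalField γ t x := by
  rw [truncField, normalField, min_eq_left hx, sq_abs]

lemma abs_truncField_sub_le {R : ℝ} (hR : 0 ≤ R) (γ : ℝ → ℝ) (t x y : ℝ) :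
    |truncField R γ t x - truncField R γ t y| ≤ 2 * R * |x - y| := by
  have h1 : |min |x| R - min |y| R| ≤ |x - y| :=
    (abs_min_sub_min_le_max _ _ _ _).trans (by simpa using abs_abs_sub_abs_le x y)
  have h2 : |min |x| R + min |y| R| ≤ 2 * R := by
    rw [abs_of_nonneg (by positivity)]
    linarith [min_le_right |x| R, min_le_right |y| R]
  calc |truncField R γ t x - truncField R γ t y|
      = |min |x| R + min |y| R| * |min |x| R - min |y| R| := by
        rw [← abs_mul]; unfold truncField; congr 1; ring
    _ ≤ 2 * R * |x - y| := by gcongr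

lemma lipschitzWith_truncField {R : ℝ} (hR : 0 ≤ R) (γ : ℝ → ℝ) (t : ℝ) :
    LipschitzWith (Real.toNNReal (2 * R)) (truncField R γ t) := by
  refine LipschitzWith.of_dist_le_mul fun x y => ?_
  rw [Real.coe_toNNReal _ (by positivity), Real.dist_eq, Real.dist_eq]
  exact abs_truncField_sub_le hR γ t x y

lemma IsSolutionFrom.continuousOn {f : ℝ → ℝ → ℝ} {T c : ℝ} {ψ : ℝ → ℝ}
    (h : IsSolutionFrom f T c ψ) : ContinuousOn ψ (Icc 0 T) :=
  fun t ht => (h.2 t ht).continuousWithinAt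

lemma IsSolutionFrom.hasDerivWithinAt_Ici {f : ℝ → ℝ → ℝ} {T c : ℝ} {ψ : ℝ → ℝ}
    (h : IsSolutionFrom f T c ψ) {t : ℝ} (ht : t ∈ Ico 0 T) :
    HasDerivWithinAt ψ (f t (ψ t)) (Ici t) t :=
  (h.2 t (Ico_subset_Icc_self ht)).mono_of_mem_nhdsWithin (Icc_mem_nhdsGE_of_mem ht)

/-- The truncated field is bounded on `[0, T]` by `R ^ 2 + K`, so a Picard–Lindelöf ball of radius
`(R ^ 2 + K) * T` serves the whole interval and no solution blows up. -/
lemma exists_isSolutionFrom_truncField {R T : ℝ} (hR : 0 ≤ R) (hT : 0 < T) {γ : ℝ → ℝ}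
    (hγ : Continuous γ) (c : ℝ) : ∃ ψ, IsSolutionFrom (truncField R γ) T c ψ := by
  obtain ⟨K, hK⟩ := isCompact_Icc.exists_bound_of_continuousOn (hγ.continuousOn (s := Icc 0 T))
  have hK0 : 0 ≤ K := (norm_nonneg _).trans (hK 0 ⟨le_rfl, hT.le⟩)
  have hP : IsPicardLindelof (truncField R γ) (tmin := 0) (tmax := T) ⟨0, le_rfl, hT.le⟩ c
      (Real.toNNReal ((R ^ 2 + K) * T)) 0 (Real.toNNReal (R ^ 2 + K)) (Real.toNNReal (2 * R)) :=
    { lipschitzOnWith := fun t _ => (lipschitzWith_truncField hR γ t).lipschitzOnWith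
      continuousOn := fun x _ => (continuous_const.add hγ).continuousOn
      norm_le := fun t ht x _ => by
        rw [Real.coe_toNNReal _ (by positivity)]
        refine (norm_add_le _ _).trans (add_le_add ?_ (hK t ht))
        rw [Real.norm_of_nonneg (by positivity)]
        exact pow_le_pow_left₀ (le_min (abs_nonneg _) hR) (min_le_right _ _) 2
      mul_max_le := by
        rw [Real.coe_toNNReal _ (by positivity), Real.coe_toNNReal _ (by positivity)]
        simp [hT.le] }
  exact hP.exists_eq_forall_mem_Icc_hasDerivWithinAt₀

/-- Continuous dependence of the solutions of the truncated equation on the data. -/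
lemma abs_sub_le_of_isSolutionFrom_truncField {R T c₁ c₂ ε : ℝ} (hR : 0 < R) (hT : 0 < T)
    {γ₁ γ₂ ψ₁ ψ₂ : ℝ → ℝ} (hγ : ∀ t, |γ₁ t - γ₂ t| ≤ ε)
    (h₁ : IsSolutionFrom (truncField R γ₁) T c₁ ψ₁)
    (h₂ : IsSolutionFrom (truncField R γ₂) T c₂ ψ₂) :
    |ψ₁ T - ψ₂ T| ≤ |c₁ - c₂| * Real.exp (2 * R * T) +
      ε / (2 * R) * (Real.exp (2 * R * T) - 1) := by
  have h := dist_le_of_approx_trajectories_ODE (v := truncField R γ₂) (εf := ε) (εg := 0)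
    (δ := |c₁ - c₂|)
    (lipschitzWith_truncField hR.le γ₂) h₁.continuousOn (fun t ht => h₁.hasDerivWithinAt_Ici ht)
    (fun t _ => by
      rw [Real.dist_eq]
      simpa [truncField] using hγ t)
    h₂.continuousOn (fun t ht => h₂.hasDerivWithinAt_Ici ht) (fun t _ => by simp)
    (by rw [h₁.1, h₂.1, Real.dist_eq]) T ⟨hT.le, le_rfl⟩
  rw [Real.coe_toNNReal _ (by positivity), gronwallBound_of_K_ne_0 (by positivity),
    Real.dist_eq] at h
  simpa using h

/-- Fixed points of the Poincaré map of the truncated equation on both sides of a point which it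
does not increase. -/
lemma exists_fixedPoint_truncField {R T : ℝ} (hR : 0 < R) (hT : 0 < T) {γ : ℝ → ℝ}
    (hγ : Continuous γ) (hγR : ∀ t, |γ t| < R ^ 2) {c : ℝ}
    (hc : ∀ ψ, IsSolutionFrom (truncField R γ) T c ψ → ψ T ≤ c) :
    (∃ c₁ ≤ c, ∃ ψ, IsSolutionFrom (truncField R γ) T c₁ ψ ∧ ψ T = c₁) ∧
    (∃ c₂ ≥ c, ∃ ψ, IsSolutionFrom (truncField R γ) T c₂ ψ ∧ ψ T = c₂) := by
  choose Ψ hΨ using exists_isSolutionFrom_truncField hR.le hT hγ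
  have hcont : Continuous fun d => Ψ d T - d := by
    refine Continuous.sub ?_ continuous_id
    refine (LipschitzWith.of_dist_le_mul (K := Real.toNNReal (Real.exp (2 * R * T)))
      fun d₁ d₂ => ?_).continuous
    rw [Real.coe_toNNReal _ (Real.exp_pos _).le, Real.dist_eq, Real.dist_eq, mul_comm]
    simpa using abs_sub_le_of_isSolutionFrom_truncField (ε := 0) hR hT (by simp) (hΨ d₁) (hΨ d₂)
  -- At the value d the truncated field is R² + γ > 0, so the constant d is a lower barrier for the
  -- solution starting there.
  have hlarge : ∀ d, R ≤ |d| → 0 ≤ Ψ d T - d := by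
    intro d hd
    have := image_le_of_deriv_right_lt_deriv_boundary' (f := fun _ => d) (f' := fun _ => 0)
      (B := Ψ d) (B' := fun t => truncField R γ t (Ψ d t)) (a := 0) (b := T)
      continuousOn_const (fun t _ => hasDerivWithinAt_const _ _ _) (hΨ d).1.ge
      (hΨ d).continuousOn (fun t ht => (hΨ d).hasDerivWithinAt_Ici ht)
      (fun t _ h => by
        have := neg_abs_le (γ t)
        have := hγR t
        simp only [← h, truncField, min_eq_right hd]
        linarith) ⟨hT.le, le_rfl⟩
    linarith
  have hc' : Ψ c T - c ≤ 0 := by linarith [hc _ (hΨ c)]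
  set M := max R |c|
  have hM : R ≤ |M| := (le_max_left _ _).trans (le_abs_self _)
  have hcM : |c| ≤ M := le_max_right _ _
  constructor
  · obtain ⟨d, hd, hd'⟩ := intermediate_value_Icc' (neg_le_of_abs_le hcM) hcont.continuousOn
      ⟨hc', hlarge (-M) (by rwa [abs_neg])⟩
    exact ⟨d, hd.2, Ψ d, hΨ d, sub_eq_zero.1 hd'⟩
  · obtain ⟨d, hd, hd'⟩ := intermediate_value_Icc (le_of_abs_le hcM) hcont.continuousOn
      ⟨hc', hlarge M hM⟩
    exact ⟨d, hd.1, Ψ d, hΨ d, sub_eq_zero.1 hd'⟩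

/-! ### Periodic solutions -/

/-- A solution on `[0, T]` with equal values at the endpoints extends to a periodic solution. -/
lemma exists_isPeriodicSolution_of_isSolutionFrom {f : ℝ → ℝ → ℝ} {T c : ℝ} (hT : 0 < T)
    (hf : Continuous (Function.uncurry f)) (hper : ∀ t x, f (t + T) x = f t x)
    {ψ : ℝ → ℝ} (hψ : IsSolutionFrom f T c ψ) (hψT : ψ T = c) :
    ∃ φ, IsPeriodicSolution f T φ ∧ φ 0 = c := by
  have : Fact (0 < T) := ⟨hT⟩
  set y : ℝ → ℝ := fun t => AddCircle.liftIco T 0 ψ (t : AddCircle T)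
  have hyc : Continuous y :=
    (AddCircle.liftIco_zero_continuous (by rw [hψ.1, hψT]) hψ.continuousOn).comp
      (AddCircle.continuous_mk' T)
  have hyp : Function.Periodic y T := fun t => by simp [y]
  have hyψ : ∀ t ∈ Icc 0 T, y t = ψ t := by
    intro t ht
    rcases ht.2.lt_or_eq with h | rfl
    · exact AddCircle.liftIco_zero_coe_apply ⟨ht.1, h⟩
    · have h0 : y 0 = ψ 0 := AddCircle.liftIco_zero_coe_apply ⟨le_rfl, hT⟩
      rw [← zero_add t, hyp 0, h0, zero_add, hψ.1, hψT]
  set g : ℝ → ℝ := fun t => f t (y t)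
  have hgc : Continuous g := hf.comp (continuous_id.prodMk hyc)
  have hgp : Function.Periodic g T := fun t => by simp only [g, hyp t, hper]
  -- The integral is differentiable from both sides everywhere, including the multiples of T where
  -- copies of ψ are glued; it remains to identify it with the periodic extension y.
  set Y : ℝ → ℝ := fun t => c + ∫ s in (0 : ℝ)..t, g s
  have hY : ∀ t, HasDerivAt Y (g t) t := fun t =>
    (intervalIntegral.integral_hasDerivAt_right (hgc.intervalIntegrable _ _)
      (hgc.stronglyMeasurableAtFilter _ _) hgc.continuousAt).const_add c
  have hYψ : ∀ t ∈ Icc 0 T, Y t = ψ t := by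
    intro t ht
    have := intervalIntegral.integral_eq_sub_of_hasDeriv_right_of_le ht.1
      (hψ.continuousOn.mono (Icc_subset_Icc_right ht.2))
      (f' := g) (fun s hs => by
        have hs' : s ∈ Ico 0 T := ⟨hs.1.le, hs.2.trans_le ht.2⟩
        have := (hψ.hasDerivWithinAt_Ici hs').mono Ioi_subset_Ici_self
        rwa [← hyψ s (Ico_subset_Icc_self hs')] at this) (hgc.intervalIntegrable _ _)
    simp only [Y, this, hψ.1]
    ring
  have hI : ∫ s in (0 : ℝ)..T, g s = 0 := by
    have := hYψ T ⟨hT.le, le_rfl⟩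
    simp only [Y, hψT] at this
    linarith
  have hYp : Function.Periodic Y T := fun t => by
    have := hgp.intervalIntegral_add_eq_add 0 t fun _ _ => hgc.intervalIntegrable _ _
    rw [zero_add, hI, add_zero] at this
    simp only [Y, this]
  have hYy : Y = y := by
    funext t
    obtain ⟨s, hs, h⟩ := (hYp.sub hyp).exists_mem_Ico₀ hT t
    have hs' := Ico_subset_Icc_self hs
    simp only [Pi.sub_apply, hYψ s hs', hyψ s hs', sub_self] at h
    linarith
  refine ⟨Y, ⟨fun t => ?_, hYp⟩, by simp [Y]⟩
  have := hY t
  simp only [g, ← hYy] at this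
  exact this

lemma IsPeriodicSolution.continuous {f : ℝ → ℝ → ℝ} {T : ℝ} {φ : ℝ → ℝ}
    (h : IsPeriodicSolution f T φ) : Continuous φ :=
  continuous_iff_continuousAt.2 fun t => (h.1 t).continuousAt

lemma IsPeriodicSolution.isSolutionFrom {f : ℝ → ℝ → ℝ} {T : ℝ} {φ : ℝ → ℝ}
    (h : IsPeriodicSolution f T φ) : IsSolutionFrom f T (φ 0) φ :=
  ⟨rfl, fun t _ => (h.1 t).hasDerivWithinAt⟩

lemma IsPeriodicSolution.apply_period {f : ℝ → ℝ → ℝ} {T : ℝ} {φ : ℝ → ℝ}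
    (h : IsPeriodicSolution f T φ) : φ T = φ 0 := by
  simpa using h.2 0

/-! ### A priori bounds, and equivalence of the truncated and original equations for periodic
solutions -/

lemma Periodic.exists_forall_ge {T : ℝ} (hT : 0 < T) {φ : ℝ → ℝ} (hc : Continuous φ)
    (hp : Function.Periodic φ T) : ∃ t₀, ∀ t, φ t ≤ φ t₀ := by
  obtain ⟨t₀, _, ht₀⟩ := isCompact_Icc.exists_isMaxOn (nonempty_Icc.2 hT.le)
    (hc.continuousOn (s := Icc 0 T))
  refine ⟨t₀, fun t => ?_⟩
  obtain ⟨s, hs, h⟩ := hp.exists_mem_Ico₀ hT t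
  exact h ▸ ht₀ (Ico_subset_Icc_self hs)

/-- If the derivative of a periodic function vanishes only at points with `|φ t| < R`, then
`|φ| < R`. -/
lemma abs_lt_of_periodic_of_deriv_eq_zero {T R : ℝ} (hT : 0 < T) {φ φ' : ℝ → ℝ}
    (hφ : ∀ t, HasDerivAt φ (φ' t) t) (hp : Function.Periodic φ T)
    (h : ∀ t, φ' t = 0 → |φ t| < R) (t : ℝ) : |φ t| < R := by
  have hc : Continuous φ := continuous_iff_continuousAt.2 fun t => (hφ t).continuousAt
  obtain ⟨t₁, h₁⟩ := Periodic.exists_forall_ge hT hc hp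
  obtain ⟨t₂, h₂⟩ := Periodic.exists_forall_ge hT hc.neg (φ := fun t => -φ t)
    fun t => by simp [hp t]
  have e₁ := h t₁ (IsLocalMax.hasDerivAt_eq_zero (Eventually.of_forall h₁) (hφ t₁))
  have e₂ := h t₂ (IsLocalMin.hasDerivAt_eq_zero
    (Eventually.of_forall fun t => neg_le_neg_iff.1 (h₂ t)) (hφ t₂))
  rw [abs_lt] at e₁ e₂ ⊢
  constructor <;> linarith [h₁ t, h₂ t]

/-- At a critical point φ² = -γ < R². With the analogous bound for the truncated equation, this
shows that truncation neither creates nor destroys periodic solutions. -/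
lemma abs_lt_of_isPeriodicSolution_normalField {T R : ℝ} (hT : 0 < T) (hR : 0 < R)
    {γ φ : ℝ → ℝ} (hγ : ∀ t, |γ t| < R ^ 2)
    (h : IsPeriodicSolution (normalField γ) T φ) (t : ℝ) : |φ t| < R := by
  refine abs_lt_of_periodic_of_deriv_eq_zero hT h.1 h.2 (fun s hs => ?_) t
  refine abs_lt_of_sq_lt_sq ?_ hR.le
  have := neg_abs_le (γ s)
  have := hγ s
  unfold normalField at hs
  linarith

lemma abs_lt_of_isPeriodicSolution_truncField {T R : ℝ} (hT : 0 < T)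
    {γ φ : ℝ → ℝ} (hγ : ∀ t, |γ t| < R ^ 2)
    (h : IsPeriodicSolution (truncField R γ) T φ) (t : ℝ) : |φ t| < R := by
  refine abs_lt_of_periodic_of_deriv_eq_zero hT h.1 h.2 (fun s hs => ?_) t
  by_contra hcon
  have := neg_abs_le (γ s)
  have := hγ s
  rw [truncField, min_eq_right (not_lt.1 hcon)] at hs
  linarith

lemma isPeriodicSolution_truncField_iff {T R : ℝ} (hT : 0 < T) (hR : 0 < R) {γ φ : ℝ → ℝ}
    (hγ : ∀ t, |γ t| < R ^ 2) :
    IsPeriodicSolution (truncField R γ) T φ ↔ IsPeriodicSolution (normalField γ) T φ := by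
  constructor <;> intro h
  · have hb := abs_lt_of_isPeriodicSolution_truncField hT hγ h
    exact ⟨fun t => truncField_eq_normalField (hb t).le γ t ▸ h.1 t, h.2⟩
  · have hb := abs_lt_of_isPeriodicSolution_normalField hT hR hγ h
    exact ⟨fun t => (truncField_eq_normalField (hb t).le γ t).symm ▸ h.1 t, h.2⟩

lemma continuous_uncurry_truncField {γ : ℝ → ℝ} (hγ : Continuous γ) (R : ℝ) :
    Continuous (Function.uncurry (truncField R γ)) := by
  unfold Function.uncurry truncField
  fun_prop

lemma exists_isPeriodicSolution_normalField {T R c : ℝ} (hT : 0 < T) (hR : 0 < R)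
    {γ ψ : ℝ → ℝ} (hγc : Continuous γ) (hγp : Function.Periodic γ T)
    (hγ : ∀ t, |γ t| < R ^ 2) (hψ : IsSolutionFrom (truncField R γ) T c ψ) (hψT : ψ T = c) :
    ∃ φ, IsPeriodicSolution (normalField γ) T φ ∧ φ 0 = c := by
  obtain ⟨φ, hφ, h0⟩ := exists_isPeriodicSolution_of_isSolutionFrom hT
    (continuous_uncurry_truncField hγc R) (fun t x => by simp [truncField, hγp t]) hψ hψT
  exact ⟨φ, (isPeriodicSolution_truncField_iff hT hR hγ).1 hφ, h0⟩

lemma Periodic.exists_abs_le {T : ℝ} (hT : 0 < T) {γ : ℝ → ℝ} (hc : Continuous γ)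
    (hp : Function.Periodic γ T) : ∃ K, 0 ≤ K ∧ ∀ t, |γ t| ≤ K := by
  obtain ⟨t₀, h⟩ := Periodic.exists_forall_ge hT hc.abs (φ := fun t => |γ t|)
    fun t => by simp [hp t]
  exact ⟨|γ t₀|, abs_nonneg _, h⟩

/-- A strict periodic subsolution separates two periodic solutions. -/
theorem exists_two_isPeriodicSolution {T δ : ℝ} (hT : 0 < T) (hδ : 0 < δ) {γ p p' : ℝ → ℝ}
    (hγc : Continuous γ) (hγp : Function.Periodic γ T)
    (hp : ∀ t, HasDerivAt p (p' t) t) (hpp : p T = p 0)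
    (hsub : ∀ t, p t ^ 2 + γ t + δ ≤ p' t) :
    ∃ φ₁ φ₂, IsPeriodicSolution (normalField γ) T φ₁ ∧
      IsPeriodicSolution (normalField γ) T φ₂ ∧ φ₁ 0 < φ₂ 0 := by
  obtain ⟨K, hK0, hK⟩ := Periodic.exists_abs_le hT hγc hγp
  set R := K + 1
  have hR : 0 < R := by positivity
  have hγR : ∀ t, |γ t| < R ^ 2 := fun t => (hK t).trans_lt (by simp only [R]; nlinarith)
  -- Moving p by e changes the truncated field by at most 2R|e| < δ, so p + e is still an upper
  -- barrier. Truncation only lowers the field, hence no bound on p is needed.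
  have key : ∀ e, 2 * R * |e| < δ → ∀ ψ, IsSolutionFrom (truncField R γ) T (p 0 + e) ψ →
      ψ T ≤ p 0 + e := by
    intro e he ψ hψ
    have := image_le_of_deriv_right_lt_deriv_boundary (B := fun t => p t + e) hψ.continuousOn
      (fun t ht => hψ.hasDerivWithinAt_Ici ht) hψ.1.le (fun t => (hp t).add_const e)
      (fun t _ h => by
        have h1 := abs_truncField_sub_le hR.le γ t (p t + e) (p t)
        rw [add_sub_cancel_left] at h1
        have h2 := truncField_le_normalField hR.le γ t (p t)
        have h3 := hsub t
        have h4 := le_abs_self (truncField R γ t (p t + e) - truncField R γ t (p t))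
        unfold normalField at h2
        rw [h]
        linarith) ⟨hT.le, le_rfl⟩
    rwa [hpp] at this
  set e := δ / (4 * R)
  have he : 0 < e := by positivity
  have he' : 2 * R * |e| < δ := by
    rw [abs_of_pos he]
    simp only [e]
    field_simp
    linarith
  obtain ⟨⟨c₁, hc₁, ψ₁, hψ₁, e₁⟩, -⟩ := exists_fixedPoint_truncField hR hT hγc hγR
    (key (-e) (by rwa [abs_neg]))
  obtain ⟨-, c₂, hc₂, ψ₂, hψ₂, e₂⟩ := exists_fixedPoint_truncField hR hT hγc hγR (key e he')
  obtain ⟨φ₁, h₁, h₁'⟩ := exists_isPeriodicSolution_normalField hT hR hγc hγp hγR hψ₁ e₁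
  obtain ⟨φ₂, h₂, h₂'⟩ := exists_isPeriodicSolution_normalField hT hR hγc hγp hγR hψ₂ e₂
  exact ⟨φ₁, φ₂, h₁, h₂, by rw [h₁', h₂']; linarith⟩

/-! ### Regularity of periodic functions -/

lemma mem_periodicC1_of_hasDerivAt {T : ℝ} {p p' : ℝ → ℝ} (h : ∀ t, HasDerivAt p (p' t) t)
    (hc : Continuous p') (hp : Function.Periodic p T) : p ∈ periodicC1 T := by
  refine ⟨contDiff_one_iff_deriv.2 ⟨fun t => (h t).differentiableAt, ?_⟩, hp⟩
  rwa [show deriv p = p' from funext fun t => (h t).deriv]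

lemma hasDerivAt_of_mem_periodicC1 {T : ℝ} {p : ℝ → ℝ} (h : p ∈ periodicC1 T) (t : ℝ) :
    HasDerivAt p (deriv p t) t :=
  (h.1.differentiable one_ne_zero t).hasDerivAt

lemma continuous_deriv_of_mem_periodicC1 {T : ℝ} {p : ℝ → ℝ} (h : p ∈ periodicC1 T) :
    Continuous (deriv p) :=
  h.1.continuous_deriv le_rfl

lemma periodic_deriv {T : ℝ} {p : ℝ → ℝ} (h : Function.Periodic p T) :
    Function.Periodic (deriv p) T := fun t => by
  rw [← deriv_comp_add_const, show (fun s => p (s + T)) = p from funext h]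

lemma continuous_normalField {γ φ : ℝ → ℝ} (hγ : Continuous γ) (hφ : Continuous φ) :
    Continuous fun t => normalField γ t (φ t) := by
  unfold normalField
  fun_prop

lemma IsPeriodicSolution.mem_periodicC1 {T : ℝ} {γ φ : ℝ → ℝ} (hγ : Continuous γ)
    (h : IsPeriodicSolution (normalField γ) T φ) : φ ∈ periodicC1 T :=
  mem_periodicC1_of_hasDerivAt h.1 (continuous_normalField hγ h.continuous) h.2

/-! ### The exponential weight -/

lemma hasDerivAt_weight {p : ℝ → ℝ} (hp : Continuous p) (t : ℝ) :
    HasDerivAt (weight p) (-2 * p t * weight p t) t := by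
  have h := ((intervalIntegral.integral_hasDerivAt_right (hp.intervalIntegrable 0 t)
    (hp.stronglyMeasurableAtFilter _ _) hp.continuousAt).const_mul (-2)).exp
  rw [mul_comm] at h
  exact h

lemma continuous_weight {p : ℝ → ℝ} (hp : Continuous p) : Continuous (weight p) :=
  continuous_iff_continuousAt.2 fun t => (hasDerivAt_weight hp t).continuousAt

lemma weight_pos (p : ℝ → ℝ) (t : ℝ) : 0 < weight p t := Real.exp_pos _

@[simp] lemma weight_zero (p : ℝ → ℝ) : weight p 0 = 1 := by simp [weight]

lemma weight_add_period {T : ℝ} {p : ℝ → ℝ} (hp : Continuous p) (hper : Function.Periodic p T)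
    (t : ℝ) : weight p (t + T) = weight p t * weight p T := by
  have := hper.intervalIntegral_add_eq_add 0 t fun _ _ => hp.intervalIntegrable _ _
  rw [zero_add] at this
  rw [weight, weight, weight, this, mul_add, Real.exp_add]

lemma weight_eq_one_iff {T : ℝ} {p : ℝ → ℝ} :
    weight p T = 1 ↔ ∫ t in (0 : ℝ)..T, p t = 0 := by
  simp [weight]

lemma integral_weight_pos {T : ℝ} (hT : 0 < T) {p : ℝ → ℝ} (hp : Continuous p) :
    0 < ∫ t in (0 : ℝ)..T, weight p t :=
  intervalIntegral.intervalIntegral_pos_of_pos ((continuous_weight hp).intervalIntegrable _ _)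
    (weight_pos p) hT

/-! ### Subsolutions and the functional `lowerMu` -/

/-- The numbers `m` such that `x' = x ^ 2 + γ (t) + m` has a periodic subsolution. -/
def subsolutionLevels (T : ℝ) (γ : ℝ → ℝ) : Set ℝ :=
  {m | ∃ p ∈ periodicC1 T, ∀ t, p t ^ 2 + γ t + m ≤ deriv p t}

lemma le_lowerMu_iff {T : ℝ} (hT : 0 < T) {γ p : ℝ → ℝ} (hγc : Continuous γ)
    (hγp : Function.Periodic γ T) (hp : p ∈ periodicC1 T) (m : ℝ) :
    m ≤ lowerMu T γ p ↔ ∀ t, p t ^ 2 + γ t + (m - average T γ) ≤ deriv p t := by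
  have hc : Continuous fun t => p t ^ 2 + centered T γ t - deriv p t :=
    ((hp.1.continuous.pow 2).add (hγc.sub continuous_const)).sub
      (continuous_deriv_of_mem_periodicC1 hp)
  have hb : BddAbove ((fun t => p t ^ 2 + centered T γ t - deriv p t) '' Icc 0 T) :=
    (isCompact_Icc.image hc).bddAbove
  rw [lowerMu, le_neg, csSup_le_iff hb ((nonempty_Icc.2 hT.le).image _), forall_mem_image]
  constructor
  · intro h t
    have hper : Function.Periodic (fun t => p t ^ 2 + centered T γ t - deriv p t) T := fun t => by
      simp only [centered, hp.2 t, hγp t, periodic_deriv hp.2 t]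
    obtain ⟨s, hs, e⟩ := hper.exists_mem_Ico₀ hT t
    have := h (Ico_subset_Icc_self hs)
    simp only [centered] at e this
    linarith
  · intro h t _
    have := h t
    simp only [centered]
    linarith

/-- At a maximum of p the derivative vanishes, so m ≤ -γ - p² ≤ K there. -/
lemma subsolutionLevels_bddAbove {T : ℝ} (hT : 0 < T) {γ : ℝ → ℝ} (hγc : Continuous γ)
    (hγp : Function.Periodic γ T) : BddAbove (subsolutionLevels T γ) := by
  obtain ⟨K, -, hK⟩ := Periodic.exists_abs_le hT hγc hγp
  refine ⟨K, ?_⟩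
  rintro m ⟨p, hp, h⟩
  obtain ⟨t₀, ht₀⟩ := Periodic.exists_forall_ge hT hp.1.continuous hp.2
  have h0 := IsLocalMax.hasDerivAt_eq_zero (Eventually.of_forall ht₀)
    (hasDerivAt_of_mem_periodicC1 hp t₀)
  have := h t₀
  have := neg_le_of_abs_le (hK t₀)
  nlinarith [sq_nonneg (p t₀)]

lemma subsolutionLevels_nonempty {T : ℝ} (hT : 0 < T) {γ : ℝ → ℝ} (hγc : Continuous γ)
    (hγp : Function.Periodic γ T) : (subsolutionLevels T γ).Nonempty := by
  obtain ⟨K, -, hK⟩ := Periodic.exists_abs_le hT hγc hγp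
  refine ⟨-K, fun _ => 0, ⟨contDiff_const, fun _ => rfl⟩, fun t => ?_⟩
  have := le_of_abs_le (hK t)
  simp only [deriv_const]
  linarith

/-- The set of levels with a periodic solution is sequentially closed. -/
lemma exists_isPeriodicSolution_of_tendsto {T m : ℝ} (hT : 0 < T) {γ : ℝ → ℝ}
    (hγc : Continuous γ) (hγp : Function.Periodic γ T) {u : ℕ → ℝ} (hu : Tendsto u atTop (𝓝 m))
    (h : ∀ n, ∃ φ, IsPeriodicSolution (normalField fun t => γ t + u n) T φ) :
    ∃ φ, IsPeriodicSolution (normalField fun t => γ t + m) T φ := by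
  choose φ hφ using h
  obtain ⟨K, hK0, hK⟩ := Periodic.exists_abs_le hT hγc hγp
  obtain ⟨M, hM⟩ := hu.abs.bddAbove_range
  have hM0 : 0 ≤ M := (abs_nonneg _).trans (hM ⟨0, rfl⟩)
  set R := K + M + 1
  have hR : 0 < R := by positivity
  have hbound : ∀ a, |a| ≤ M → ∀ t, |γ t + a| < R ^ 2 := fun a ha t => by
    have := (abs_add_le (γ t) a).trans (add_le_add (hK t) ha)
    simp only [R]
    nlinarith
  have hm : |m| ≤ M := le_of_tendsto' hu.abs fun n => hM ⟨n, rfl⟩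
  have hu' : ∀ n, ∀ t, |γ t + u n| < R ^ 2 := fun n => hbound _ (hM ⟨n, rfl⟩)
  obtain ⟨c, -, s, hs, hc⟩ := (isCompact_Icc (a := -R) (b := R)).tendsto_subseq
    (x := fun n => φ n 0) fun n =>
      abs_le.1 (abs_lt_of_isPeriodicSolution_normalField hT hR (hu' n) (hφ n) 0).le
  have hcont : Continuous fun t => γ t + m := by fun_prop
  obtain ⟨ψ, hψ⟩ := exists_isSolutionFrom_truncField hR.le hT hcont c
  -- Since each φ returns to its initial value after time T, continuous dependence makes these
  -- values converge to ψ(T) as well as to c.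
  have hlim : Tendsto (fun n => φ (s n) 0) atTop (𝓝 (ψ T)) := by
    rw [tendsto_iff_dist_tendsto_zero]
    refine squeeze_zero (g := fun n => |φ (s n) 0 - c| * Real.exp (2 * R * T) +
      |u (s n) - m| / (2 * R) * (Real.exp (2 * R * T) - 1)) (fun _ => dist_nonneg) (fun n => ?_) ?_
    · have := abs_sub_le_of_isSolutionFrom_truncField (ε := |u (s n) - m|) hR hT (by simp)
        ((isPeriodicSolution_truncField_iff hT hR (hu' (s n))).2 (hφ (s n))).isSolutionFrom hψ
      rwa [(hφ (s n)).apply_period] at this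
    · have h1 : Tendsto (fun n => |φ (s n) 0 - c|) atTop (𝓝 0) := by
        simpa using (hc.sub_const c).abs
      have h2 : Tendsto (fun n => |u (s n) - m|) atTop (𝓝 0) := by
        simpa using ((hu.comp hs.tendsto_atTop).sub_const m).abs
      simpa using (h1.mul_const (Real.exp (2 * R * T))).add
        ((h2.div_const (2 * R)).mul_const (Real.exp (2 * R * T) - 1))
  obtain ⟨χ, hχ, -⟩ := exists_isPeriodicSolution_normalField hT hR hcont
    (fun t => by simp [hγp t]) (hbound m hm) hψ (tendsto_nhds_unique hlim hc)
  exact ⟨χ, hχ⟩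

/-- A periodic solution of nonzero mean can be perturbed to a strict periodic subsolution. -/
lemma exists_strict_subsolution {T : ℝ} (hT : 0 < T) {γ φ : ℝ → ℝ}
    (hγc : Continuous γ) (hφ : IsPeriodicSolution (normalField γ) T φ)
    (hne : ∫ t in (0 : ℝ)..T, φ t ≠ 0) : ∃ δ > 0, δ ∈ subsolutionLevels T γ := by
  have hc := hφ.continuous
  have hWc := continuous_weight hc
  set W := weight φ
  have hW : ∀ t, W t ≠ 0 := fun t => (weight_pos φ t).ne'
  have hWT : W T - 1 ≠ 0 := sub_ne_zero.2 fun h => hne (weight_eq_one_iff.1 h)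
  set J : ℝ → ℝ := fun t => ∫ s in (0 : ℝ)..t, W s
  have hJ : ∀ t, HasDerivAt J (W t) t := fun t =>
    intervalIntegral.integral_hasDerivAt_right (hWc.intervalIntegrable _ _)
      (hWc.stronglyMeasurableAtFilter _ _) hWc.continuousAt
  have hJT : ∀ t, J (t + T) = J T + W T * J t := fun t => by
    have h1 : J (t + T) = J T + ∫ s in T..(t + T), W s :=
      (intervalIntegral.integral_add_adjacent_intervals (hWc.intervalIntegrable _ _)
        (hWc.intervalIntegrable _ _)).symm
    have h2 : ∫ s in T..(t + T), W s = ∫ s in (0 : ℝ)..t, W (s + T) := by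
      rw [intervalIntegral.integral_comp_add_right, zero_add]
    rw [h1, h2]
    simp only [W, weight_add_period hc hφ.2, intervalIntegral.integral_mul_const]
    simp only [J, W]
    ring
  -- The periodic solution of d' = 2φd + 1. Periodicity forces d(0) = J(T) / (W(T) - 1), which is
  -- where the nonzero mean enters.
  set d : ℝ → ℝ := fun t => (J T / (W T - 1) + J t) / W t
  have hd : ∀ t, HasDerivAt d (1 + 2 * φ t * d t) t := fun t => by
    refine (((hJ t).const_add (J T / (W T - 1))).div (hasDerivAt_weight hc t) (hW t)).congr_deriv ?_
    have := hW t
    simp only [d]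
    change (W t * W t - _ * (-2 * φ t * W t)) / W t ^ 2 = _
    generalize J T / (W T - 1) + J t = z
    field_simp
    ring
  have hdc : Continuous d := continuous_iff_continuousAt.2 fun t => (hd t).continuousAt
  have hdp : Function.Periodic d T := fun t => by
    have e : W (t + T) = W t * W T := weight_add_period hc hφ.2 t
    have h1 := hW t
    have h2 := hW T
    simp only [d, hJT, e]
    field_simp
    ring
  obtain ⟨B, hB0, hB⟩ := Periodic.exists_abs_le hT hdc hdp
  set e : ℝ := 1 / (2 * (B ^ 2 + 1))
  have he : 0 < e := by positivity
  have heB : e * B ^ 2 ≤ 1 / 2 := by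
    simp only [e]
    rw [div_mul_eq_mul_div, div_le_div_iff₀ (by positivity) (by positivity)]
    linarith
  -- For p = φ + e d one has p' - p² - γ = e - e²d², which is at least e/2 because e d² ≤ 1/2.
  have hp : ∀ t, HasDerivAt (fun t => φ t + e * d t)
      (normalField γ t (φ t) + e * (1 + 2 * φ t * d t)) t :=
    fun t => (hφ.1 t).add ((hd t).const_mul e)
  refine ⟨e / 2, by positivity, _, mem_periodicC1_of_hasDerivAt hp
    ((continuous_normalField hγc hc).add (by fun_prop)) (fun t => by simp [hφ.2 t, hdp t]),
    fun t => ?_⟩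
  rw [(hp t).deriv, normalField]
  have h1 : e * d t ^ 2 ≤ 1 / 2 := by
    rw [← sq_abs]
    exact (mul_le_mul_of_nonneg_left (pow_le_pow_left₀ (abs_nonneg _) (hB t) 2) he.le).trans heB
  nlinarith

/-- There is a level at which there is a periodic solution with zero mean. -/
theorem exists_zeroMean_isPeriodicSolution {T : ℝ} (hT : 0 < T) {γ : ℝ → ℝ}
    (hγc : Continuous γ) (hγp : Function.Periodic γ T) :
    ∃ D φ, IsPeriodicSolution (normalField fun t => γ t + D) T φ ∧
      ∫ t in (0 : ℝ)..T, φ t = 0 := by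
  have hbdd := subsolutionLevels_bddAbove hT hγc hγp
  set D := sSup (subsolutionLevels T γ)
  have hu : Tendsto (fun n : ℕ => D - 1 / ((n : ℝ) + 1)) atTop (𝓝 D) := by
    simpa using tendsto_one_div_add_atTop_nhds_zero_nat.const_sub D
  obtain ⟨φ, hφ⟩ := exists_isPeriodicSolution_of_tendsto hT hγc hγp hu fun n => by
    obtain ⟨m, ⟨p, hp, hm⟩, hlt⟩ := exists_lt_of_lt_csSup
      (subsolutionLevels_nonempty hT hγc hγp)
      (sub_lt_self D (by positivity : (0 : ℝ) < 1 / ((n : ℝ) + 1)))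
    obtain ⟨φ, -, hφ, -⟩ := exists_two_isPeriodicSolution hT (sub_pos.2 hlt)
      (γ := fun t => γ t + (D - 1 / ((n : ℝ) + 1))) (by fun_prop) (fun t => by simp [hγp t])
      (hasDerivAt_of_mem_periodicC1 hp) (by simpa using hp.2 0)
      fun t => by have := hm t; linarith
    exact ⟨φ, hφ⟩
  refine ⟨D, φ, hφ, ?_⟩
  by_contra hne
  obtain ⟨δ, hδ, p, hp, h⟩ := exists_strict_subsolution hT (by fun_prop) hφ hne
  have := le_csSup hbdd (show D + δ ∈ subsolutionLevels T γ from
    ⟨p, hp, fun t => by have := h t; linarith⟩)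
  linarith

/-! ### Consequences of a periodic solution with zero mean -/

/-- The weight is the integrating factor of the linearization along φ; what survives in the
derivative is quadratic in p - φ plus the defect. For φ of mean zero the weight is itself periodic.
-/
lemma hasDerivAt_weight_mul_sub {p φ : ℝ → ℝ} {t p' φ' : ℝ} (hφc : Continuous φ)
    (hp : HasDerivAt p p' t) (hφ : HasDerivAt φ φ' t) :
    HasDerivAt (fun t => weight φ t * (p t - φ t))
      (weight φ t * (p' - φ' - 2 * φ t * (p t - φ t))) t := by
  refine ((hasDerivAt_weight hφc t).mul (hp.sub hφ)).congr_deriv ?_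
  simp only [Pi.sub_apply]
  ring

lemma weight_periodic {T : ℝ} {φ : ℝ → ℝ} (hφc : Continuous φ) (hφp : Function.Periodic φ T)
    (hφ0 : ∫ t in (0 : ℝ)..T, φ t = 0) : Function.Periodic (weight φ) T := fun t => by
  rw [weight_add_period hφc hφp, weight_eq_one_iff.2 hφ0, mul_one]

/-- The level of the periodic solution with zero mean is the greatest subsolution level. -/
lemma le_of_mem_subsolutionLevels {T D m : ℝ} (hT : 0 < T) {γ φ : ℝ → ℝ}
    (hφ : IsPeriodicSolution (normalField fun t => γ t + D) T φ)
    (hφ0 : ∫ t in (0 : ℝ)..T, φ t = 0) (hm : m ∈ subsolutionLevels T γ) : m ≤ D := by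
  obtain ⟨p, hp, h⟩ := hm
  by_contra! hlt
  have hd := fun t => hasDerivAt_weight_mul_sub hφ.continuous
    (hasDerivAt_of_mem_periodicC1 hp t) (hφ.1 t)
  -- Rolle's theorem contradicts the derivative being at least weight · ((p - φ)² + m - D) > 0.
  obtain ⟨t, -, ht⟩ := exists_hasDerivAt_eq_zero hT
    (fun t _ => (hd t).continuousAt.continuousWithinAt)
    (by
      have hpT : p T = p 0 := by simpa using hp.2 0
      rw [weight_eq_one_iff.2 hφ0, weight_zero, hpT, hφ.apply_period])
    (fun t _ => hd t)
  have h1 := (mul_eq_zero.1 ht).resolve_left (weight_pos φ t).ne'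
  have h2 := h t
  rw [normalField] at h1
  nlinarith [sq_nonneg (p t - φ t)]

lemma _root_.Monotone.eq_of_periodic {T : ℝ} (hT : 0 < T) {f : ℝ → ℝ} (hf : Monotone f)
    (hp : Function.Periodic f T) (s t : ℝ) : f s = f t := by
  have key : ∀ s t, f s ≤ f t := fun s t => by
    obtain ⟨n, hn⟩ := Archimedean.arch (s - t) hT
    rw [← hp.nsmul n t]
    exact hf (by linarith)
  exact le_antisymm (key s t) (key t s)

/-- A periodic solution with zero mean is the only periodic solution. -/
lemma eq_of_isPeriodicSolution_of_zeroMean {T : ℝ} (hT : 0 < T) {γ φ ψ : ℝ → ℝ}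
    (hφ : IsPeriodicSolution (normalField γ) T φ) (hφ0 : ∫ t in (0 : ℝ)..T, φ t = 0)
    (hψ : IsPeriodicSolution (normalField γ) T ψ) : ψ = φ := by
  have hd := fun t => hasDerivAt_weight_mul_sub hφ.continuous (hψ.1 t) (hφ.1 t)
  have hd' : ∀ t, normalField γ t (ψ t) - normalField γ t (φ t) - 2 * φ t * (ψ t - φ t) =
      (ψ t - φ t) ^ 2 := fun t => by unfold normalField; ring
  simp only [hd'] at hd
  have hmono : Monotone fun t => weight φ t * (ψ t - φ t) :=
    monotone_of_deriv_nonneg (fun t => (hd t).differentiableAt) fun t => by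
      rw [(hd t).deriv]
      exact mul_nonneg (weight_pos φ t).le (sq_nonneg _)
  have hper : Function.Periodic (fun t => weight φ t * (ψ t - φ t)) T := fun t => by
    simp only [weight_periodic hφ.continuous hφ.2 hφ0 t, hφ.2 t, hψ.2 t]
  funext t
  have hconst : (fun t => weight φ t * (ψ t - φ t)) = fun _ => weight φ 0 * (ψ 0 - φ 0) :=
    funext fun t => hmono.eq_of_periodic hT hper t 0
  have h0 := (hd t).unique (hconst ▸ hasDerivAt_const t _)
  exact sub_eq_zero.1 (pow_eq_zero_iff two_ne_zero |>.1
    ((mul_eq_zero.1 h0).resolve_left (weight_pos φ t).ne'))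

/-- Two different periodic solutions have opposite means. -/
lemma integral_add_eq_zero_of_ne {T : ℝ} {γ φ ψ : ℝ → ℝ}
    (hφ : IsPeriodicSolution (normalField γ) T φ)
    (hψ : IsPeriodicSolution (normalField γ) T ψ) (hne : ψ ≠ φ) :
    (∫ t in (0 : ℝ)..T, φ t) + ∫ t in (0 : ℝ)..T, ψ t = 0 := by
  -- The difference satisfies (ψ - φ)' = (ψ + φ)(ψ - φ); the half compensates the factor 2 in
  -- `weight`.
  have hc : Continuous fun t => (φ t + ψ t) / 2 :=
    (hφ.continuous.add hψ.continuous).div_const 2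
  have hd : ∀ t, HasDerivAt (fun t => weight (fun t => (φ t + ψ t) / 2) t * (ψ t - φ t)) 0 t :=
    fun t => by
      refine ((hasDerivAt_weight hc t).mul ((hψ.1 t).sub (hφ.1 t))).congr_deriv ?_
      simp only [Pi.sub_apply, normalField]
      ring
  have hconst : ∀ t, weight (fun t => (φ t + ψ t) / 2) t * (ψ t - φ t) = ψ 0 - φ 0 := fun t => by
    have := is_const_of_deriv_eq_zero (fun t => (hd t).differentiableAt)
      (fun t => (hd t).deriv) t 0
    simpa using this
  have hne0 : ψ 0 - φ 0 ≠ 0 := fun h0 => hne <| funext fun t => by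
    have := hconst t
    rw [h0, mul_eq_zero] at this
    exact sub_eq_zero.1 (this.resolve_left (weight_pos _ t).ne')
  have hT := hconst T
  rw [hψ.apply_period, hφ.apply_period, mul_eq_right₀ hne0, weight_eq_one_iff,
    intervalIntegral.integral_div, intervalIntegral.integral_add
      (hφ.continuous.intervalIntegrable _ _) (hψ.continuous.intervalIntegrable _ _)] at hT
  linarith

/-- Above a strict subsolution level there are exactly two periodic solutions, of nonzero mean. -/
lemma exists_exactly_two_isPeriodicSolution {T m : ℝ} (hT : 0 < T) {γ : ℝ → ℝ}
    (hγc : Continuous γ) (hγp : Function.Periodic γ T) (hm : m ∈ subsolutionLevels T γ)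
    (hm0 : 0 < m) :
    ∃ φ₁ φ₂, φ₁ ≠ φ₂ ∧ IsPeriodicSolution (normalField γ) T φ₁ ∧
      IsPeriodicSolution (normalField γ) T φ₂ ∧
      (∫ t in (0 : ℝ)..T, φ₁ t) ≠ 0 ∧ (∫ t in (0 : ℝ)..T, φ₂ t) ≠ 0 ∧
      ∀ ψ, IsPeriodicSolution (normalField γ) T ψ → ψ = φ₁ ∨ ψ = φ₂ := by
  obtain ⟨p, hp, h⟩ := hm
  obtain ⟨φ₁, φ₂, h₁, h₂, hlt⟩ := exists_two_isPeriodicSolution hT hm0 hγc hγp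
    (hasDerivAt_of_mem_periodicC1 hp) (by simpa using hp.2 0) h
  have hne : φ₁ ≠ φ₂ := fun e => by simp [e] at hlt
  have n₁ : (∫ t in (0 : ℝ)..T, φ₁ t) ≠ 0 := fun e =>
    hne (eq_of_isPeriodicSolution_of_zeroMean hT h₁ e h₂).symm
  refine ⟨φ₁, φ₂, hne, h₁, h₂, n₁, fun e =>
    hne (eq_of_isPeriodicSolution_of_zeroMean hT h₂ e h₁), fun ψ hψ => ?_⟩
  -- Three distinct solutions would have means summing pairwise to zero, so all three means would
  -- vanish.
  by_contra! hcon
  have e₁ := integral_add_eq_zero_of_ne h₁ hψ hcon.1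
  have e₂ := integral_add_eq_zero_of_ne h₂ hψ hcon.2
  have e₃ := integral_add_eq_zero_of_ne h₁ h₂ hne.symm
  exact n₁ (by linarith)

/-! ### The variational characterizations -/

lemma isGreatest_lowerMu {T D : ℝ} (hT : 0 < T) {γ φ : ℝ → ℝ}
    (hγc : Continuous γ) (hγp : Function.Periodic γ T)
    (hφ : IsPeriodicSolution (normalField fun t => γ t + D) T φ)
    (hφ0 : ∫ t in (0 : ℝ)..T, φ t = 0) :
    IsGreatest (lowerMu T γ '' periodicC1 T) (D + average T γ) := by
  have hub : ∀ p ∈ periodicC1 T, lowerMu T γ p ≤ D + average T γ := fun p hp => by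
    have := le_of_mem_subsolutionLevels hT hφ hφ0
      ⟨p, hp, (le_lowerMu_iff hT hγc hγp hp _).1 le_rfl⟩
    linarith
  have hmem : φ ∈ periodicC1 T := hφ.mem_periodicC1 (by fun_prop)
  refine ⟨⟨φ, hmem, le_antisymm (hub φ hmem) ?_⟩, forall_mem_image.2 hub⟩
  refine (le_lowerMu_iff hT hγc hγp hmem _).2 fun t => ?_
  rw [(hφ.1 t).deriv, normalField]
  linarith

/-- With w = `weight q`, the integrand of `upperMu` is (D + average)w + w(q - φ)² - (wφ)', and the
last term integrates to zero because wφ is equal at 0 and T. Only q needs zero mean here, not φ. -/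
lemma upperMu_eq {T D : ℝ} (hT : 0 < T) {γ φ q : ℝ → ℝ} (hγc : Continuous γ)
    (hφ : IsPeriodicSolution (normalField fun t => γ t + D) T φ) (hq : q ∈ periodicC1Zero T) :
    upperMu T γ q = D + average T γ + (∫ t in (0 : ℝ)..T, weight q t)⁻¹ *
      ∫ t in (0 : ℝ)..T, weight q t * (q t - φ t) ^ 2 := by
  have hqc : Continuous q := hq.1.1.continuous
  have hφc := hφ.continuous
  have hWc := continuous_weight hqc
  have hpos := integral_weight_pos hT hqc
  have hq0 : ∫ t in (0 : ℝ)..T, q t = 0 :=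
    (mul_eq_zero.1 hq.2).resolve_left (one_div_pos.2 hT).ne'
  have hder : ∀ t, HasDerivAt (fun t => weight q t * φ t)
      (weight q t * (φ t ^ 2 + (γ t + D) - 2 * q t * φ t)) t := fun t => by
    refine ((hasDerivAt_weight hqc t).mul (hφ.1 t)).congr_deriv ?_
    simp only [normalField]
    ring
  have hint : ∫ t in (0 : ℝ)..T, weight q t * (φ t ^ 2 + (γ t + D) - 2 * q t * φ t) = 0 := by
    rw [intervalIntegral.integral_eq_sub_of_hasDerivAt (fun t _ => hder t)
      (Continuous.intervalIntegrable (by fun_prop) _ _), weight_eq_one_iff.2 hq0, weight_zero,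
      hφ.apply_period, sub_self]
  have hsplit : ∀ t, weight q t * (q t ^ 2 - centered T γ t) =
      (D + average T γ) * weight q t + weight q t * (q t - φ t) ^ 2 -
        weight q t * (φ t ^ 2 + (γ t + D) - 2 * q t * φ t) := fun t => by
    unfold centered
    ring
  have hcongr : ∫ t in (0 : ℝ)..T, weight q t * (q t ^ 2 - centered T γ t) =
      (D + average T γ) * (∫ t in (0 : ℝ)..T, weight q t) +
        ∫ t in (0 : ℝ)..T, weight q t * (q t - φ t) ^ 2 := by
    simp only [hsplit]
    rw [intervalIntegral.integral_sub (Continuous.intervalIntegrable (by fun_prop) _ _)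
      (Continuous.intervalIntegrable (by fun_prop) _ _),
      intervalIntegral.integral_add (Continuous.intervalIntegrable (by fun_prop) _ _)
      (Continuous.intervalIntegrable (by fun_prop) _ _), hint,
      intervalIntegral.integral_const_mul, sub_zero]
  rw [upperMu, hcongr]
  field_simp

lemma isLeast_upperMu {T D : ℝ} (hT : 0 < T) {γ φ : ℝ → ℝ} (hγc : Continuous γ)
    (hφ : IsPeriodicSolution (normalField fun t => γ t + D) T φ)
    (hφ0 : ∫ t in (0 : ℝ)..T, φ t = 0) :
    IsLeast (upperMu T γ '' periodicC1Zero T) (D + average T γ) := by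
  constructor
  · have hmem : φ ∈ periodicC1Zero T :=
      ⟨hφ.mem_periodicC1 (by fun_prop), by rw [average, hφ0, mul_zero]⟩
    exact ⟨φ, hmem, by simp [upperMu_eq hT hγc hφ hmem]⟩
  · rintro _ ⟨q, hq, rfl⟩
    rw [upperMu_eq hT hγc hφ hq]
    refine le_add_of_nonneg_right (mul_nonneg
      (inv_nonneg.2 (integral_weight_pos hT hq.1.1.continuous).le)
      (intervalIntegral.integral_nonneg hT.le fun t _ => ?_))
    exact mul_nonneg (weight_pos q t).le (sq_nonneg _)

lemma discriminant_eq {T D : ℝ} (hT : 0 < T) {γ φ : ℝ → ℝ}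
    (hγc : Continuous γ) (hγp : Function.Periodic γ T)
    (hφ : IsPeriodicSolution (normalField fun t => γ t + D) T φ)
    (hφ0 : ∫ t in (0 : ℝ)..T, φ t = 0) : discriminant T γ = D := by
  rw [discriminant, gammaStar, (isGreatest_lowerMu hT hγc hγp hφ hφ0).csSup_eq,
    add_sub_cancel_right]

/-- The maximum of `lowerMu` and the minimum of `upperMu` exist and are equal. -/
theorem gammaStar_isGreatest_isLeast {T : ℝ} (hT : 0 < T) {γ : ℝ → ℝ}
    (hγc : Continuous γ) (hγp : Function.Periodic γ T) :
    IsGreatest (lowerMu T γ '' periodicC1 T) (gammaStar T γ) ∧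
      IsLeast (upperMu T γ '' periodicC1Zero T) (gammaStar T γ) := by
  obtain ⟨D, φ, hφ, hφ0⟩ := exists_zeroMean_isPeriodicSolution hT hγc hγp
  have h := isGreatest_lowerMu hT hγc hγp hφ hφ0
  rw [gammaStar, h.csSup_eq]
  exact ⟨h, isLeast_upperMu hT hγc hφ hφ0⟩

theorem exists_isPeriodicSolution_discriminant {T : ℝ} (hT : 0 < T) {γ : ℝ → ℝ}
    (hγc : Continuous γ) (hγp : Function.Periodic γ T) :
    ∃ φ, IsPeriodicSolution (normalField fun t => γ t + discriminant T γ) T φ ∧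
      ∫ t in (0 : ℝ)..T, φ t = 0 := by
  obtain ⟨D, φ, hφ, hφ0⟩ := exists_zeroMean_isPeriodicSolution hT hγc hγp
  rw [discriminant_eq hT hγc hγp hφ hφ0]
  exact ⟨φ, hφ, hφ0⟩

/-- The discriminant is the greatest level with a periodic subsolution. -/
theorem isGreatest_discriminant {T : ℝ} (hT : 0 < T) {γ : ℝ → ℝ}
    (hγc : Continuous γ) (hγp : Function.Periodic γ T) :
    IsGreatest (subsolutionLevels T γ) (discriminant T γ) := by
  obtain ⟨φ, hφ, hφ0⟩ := exists_isPeriodicSolution_discriminant hT hγc hγp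
  refine ⟨⟨φ, hφ.mem_periodicC1 (by fun_prop), fun t => ?_⟩,
    fun m hm => le_of_mem_subsolutionLevels hT hφ hφ0 hm⟩
  rw [(hφ.1 t).deriv, normalField]
  linarith

/-! ### The displacement map of a Riccati equation near a periodic solution -/

/-- The right-hand side of `u' = a (t) u ^ 2 + b (t)`. -/
def quadField (a b : ℝ → ℝ) (t u : ℝ) : ℝ := a t * u ^ 2 + b t

/-- The field is only locally Lipschitz, but both solutions stay in a bounded strip over `[0, T]`.
This makes `displacement` independent of the chosen solution. -/
lemma IsSolutionFrom.eqOn_quadField {a b ψ₁ ψ₂ : ℝ → ℝ} {T c : ℝ} (ha : Continuous a)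
    (h₁ : IsSolutionFrom (quadField a b) T c ψ₁) (h₂ : IsSolutionFrom (quadField a b) T c ψ₂) :
    EqOn ψ₁ ψ₂ (Icc 0 T) := by
  obtain ⟨M₁, hM₁⟩ := isCompact_Icc.exists_bound_of_continuousOn h₁.continuousOn
  obtain ⟨M₂, hM₂⟩ := isCompact_Icc.exists_bound_of_continuousOn h₂.continuousOn
  obtain ⟨K, hK⟩ := isCompact_Icc.exists_bound_of_continuousOn (ha.continuousOn (s := Icc 0 T))
  set M := max M₁ M₂
  refine ODE_solution_unique_of_mem_Icc_right (v := quadField a b) (s := fun _ => {u | |u| ≤ M})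
    (K := Real.toNNReal (K * (2 * M))) (fun t ht => ?_)
    h₁.continuousOn (fun t ht => h₁.hasDerivWithinAt_Ici ht)
    (fun t ht => (hM₁ t (Ico_subset_Icc_self ht)).trans (le_max_left _ _))
    h₂.continuousOn (fun t ht => h₂.hasDerivWithinAt_Ici ht)
    (fun t ht => (hM₂ t (Ico_subset_Icc_self ht)).trans (le_max_right _ _))
    (h₁.1.trans h₂.1.symm)
  refine LipschitzOnWith.of_dist_le_mul fun u hu v hv => ?_
  have hu' : |u| ≤ M := hu
  have hv' : |v| ≤ M := hv
  have hat : |a t| ≤ K := hK t (Ico_subset_Icc_self ht)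
  have hM0 : 0 ≤ M := (abs_nonneg u).trans hu'
  have hK0 : 0 ≤ K := (abs_nonneg _).trans hat
  have huv : |u + v| ≤ 2 * M := (abs_add_le u v).trans (by linarith)
  rw [Real.coe_toNNReal _ (by positivity), Real.dist_eq, Real.dist_eq,
    show quadField a b t u - quadField a b t v = a t * (u + v) * (u - v) by
      unfold quadField; ring, abs_mul, abs_mul]
  gcongr

lemma displacement_eq {a b ψ : ℝ → ℝ} {T c : ℝ} (hT : 0 ≤ T) (ha : Continuous a)
    (h : IsSolutionFrom (quadField a b) T c ψ) :
    displacement (quadField a b) T c = ψ T - c := by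
  have hex : ∃ ψ, IsSolutionFrom (quadField a b) T c ψ := ⟨ψ, h⟩
  rw [displacement, dif_pos hex, hex.choose_spec.eqOn_quadField ha h ⟨hT, le_rfl⟩]

/-- The fundamental solution of the linearization along `φ`. -/
def linearFlow (a φ : ℝ → ℝ) : ℝ → ℝ := weight fun t => -(a t * φ t)

/-- The solutions close to a periodic solution, in closed form. -/
lemma isSolutionFrom_add {a b φ : ℝ → ℝ} {T d : ℝ} (ha : Continuous a)
    (hφ : IsPeriodicSolution (quadField a b) T φ)
    (hd : ∀ t ∈ Icc 0 T, d * (∫ s in (0 : ℝ)..t, a s * linearFlow a φ s) ≠ 1) :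
    IsSolutionFrom (quadField a b) T (φ 0 + d) fun t =>
      φ t + linearFlow a φ t * d / (1 - d * ∫ s in (0 : ℝ)..t, a s * linearFlow a φ s) := by
  have hc : Continuous fun t => -(a t * φ t) := (ha.mul hφ.continuous).neg
  have hE : ∀ t, HasDerivAt (linearFlow a φ) (-2 * -(a t * φ t) * linearFlow a φ t) t :=
    hasDerivAt_weight hc
  have haE : Continuous fun s => a s * linearFlow a φ s := ha.mul (continuous_weight hc)
  have hI : ∀ t, HasDerivAt (fun t => ∫ s in (0 : ℝ)..t, a s * linearFlow a φ s)
      (a t * linearFlow a φ t) t := fun t =>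
    intervalIntegral.integral_hasDerivAt_right (haE.intervalIntegrable _ _)
      (haE.stronglyMeasurableAtFilter _ _) haE.continuousAt
  -- For u = φ + v the equation is of Bernoulli type, v' = 2aφv + av², and 1/v solves a linear
  -- equation; this gives the closed form, valid while its denominator is nonzero.
  refine ⟨by simp [linearFlow], fun t ht => HasDerivAt.hasDerivWithinAt ?_⟩
  have hne : 1 - d * (∫ s in (0 : ℝ)..t, a s * linearFlow a φ s) ≠ 0 :=
    sub_ne_zero.2 (hd t ht).symm
  refine ((hφ.1 t).add (((hE t).mul_const d).div (((hI t).const_mul d).const_sub 1)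
    hne)).congr_deriv ?_
  simp only [quadField]
  generalize (∫ s in (0 : ℝ)..t, a s * linearFlow a φ s) = I at *
  generalize linearFlow a φ t = E
  field_simp
  ring

lemma eventually_isSolutionFrom_add {a b φ : ℝ → ℝ} {T : ℝ} (ha : Continuous a)
    (hφ : IsPeriodicSolution (quadField a b) T φ) :
    ∀ᶠ x in 𝓝 (φ 0), IsSolutionFrom (quadField a b) T x fun t =>
      φ t + linearFlow a φ t * (x - φ 0) /
        (1 - (x - φ 0) * ∫ s in (0 : ℝ)..t, a s * linearFlow a φ s) := by
  have haE : Continuous fun s => a s * linearFlow a φ s :=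
    ha.mul (continuous_weight (ha.mul hφ.continuous).neg)
  obtain ⟨B, hB⟩ := isCompact_Icc.exists_bound_of_continuousOn
    ((intervalIntegral.continuous_primitive (μ := MeasureTheory.volume)
      (fun _ _ => haE.intervalIntegrable _ _) 0).continuousOn
      (s := Icc 0 T))
  have hlim : Tendsto (fun x => |x - φ 0| * B) (𝓝 (φ 0)) (𝓝 0) := by
    have : Continuous fun x => |x - φ 0| * B := by fun_prop
    simpa using this.tendsto (φ 0)
  filter_upwards [hlim.eventually (gt_mem_nhds one_pos)] with x hx
  have := isSolutionFrom_add (d := x - φ 0) ha hφ fun t ht h => by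
    have h1 := congrArg abs h
    rw [abs_mul, abs_one] at h1
    have := mul_le_mul_of_nonneg_left (hB t ht) (abs_nonneg (x - φ 0))
    rw [Real.norm_eq_abs] at this
    linarith
  rwa [add_sub_cancel] at this

lemma displacement_eventuallyEq {a b φ : ℝ → ℝ} {T : ℝ} (hT : 0 ≤ T) (ha : Continuous a)
    (hφ : IsPeriodicSolution (quadField a b) T φ) :
    displacement (quadField a b) T =ᶠ[𝓝 (φ 0)] fun x =>
      linearFlow a φ T * (x - φ 0) /
        (1 - (x - φ 0) * ∫ s in (0 : ℝ)..T, a s * linearFlow a φ s) - (x - φ 0) := by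
  filter_upwards [eventually_isSolutionFrom_add ha hφ] with x hx
  rw [displacement_eq hT ha hx, hφ.apply_period]
  ring

lemma hasDerivAt_mobius {E I c x : ℝ} (hx : 1 - (x - c) * I ≠ 0) :
    HasDerivAt (fun x => E * (x - c) / (1 - (x - c) * I) - (x - c))
      (E / (1 - (x - c) * I) ^ 2 - 1) x := by
  have h := (hasDerivAt_id' x).sub_const c
  refine (((h.const_mul E).div ((h.mul_const I).const_sub 1) hx).sub h).congr_deriv ?_
  field_simp
  ring

lemma contDiffAt_mobius (E I c : ℝ) (n : WithTop ℕ∞) :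
    ContDiffAt ℝ n (fun x => E * (x - c) / (1 - (x - c) * I) - (x - c)) c := by
  have h : ContDiffAt ℝ n (fun x : ℝ => x - c) c := contDiffAt_id.sub contDiffAt_const
  exact ((contDiffAt_const.mul h).div (contDiffAt_const.sub (h.mul contDiffAt_const))
    (by simp)).sub h

/-- The displacement has derivative E - 1 at φ(0), where E = exp(2∫aφ) over a period. -/
lemma isHyperbolic_quadField {a b φ : ℝ → ℝ} {T : ℝ} (hT : 0 ≤ T) (ha : Continuous a)
    (hφ : IsPeriodicSolution (quadField a b) T φ)
    (hne : (∫ t in (0 : ℝ)..T, a t * φ t) ≠ 0) : IsHyperbolic (quadField a b) T φ := by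
  have hev := displacement_eventuallyEq hT ha hφ
  refine ⟨(eventually_isSolutionFrom_add ha hφ).mono fun x hx => ⟨_, hx⟩,
    (contDiffAt_mobius _ _ _ _).congr_of_eventuallyEq hev, fun k hk => ?_, ?_⟩
  · obtain rfl : k = 0 := by omega
    simp [hev.eq_of_nhds]
  · rw [iteratedDeriv_one, hev.deriv_eq, (hasDerivAt_mobius (by simp)).deriv]
    simp only [sub_self, zero_mul, sub_zero, one_pow, div_one]
    refine sub_ne_zero.2 fun h => hne ?_
    have := weight_eq_one_iff.1 h
    rwa [intervalIntegral.integral_neg, neg_eq_zero] at this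

/-- Here E = 1, so the first derivative vanishes; the second is 2∫aE over a period, nonzero because
a has constant sign. -/
lemma isDouble_quadField {a b φ : ℝ → ℝ} {T : ℝ} (hT : 0 < T) (ha : Continuous a)
    (ha0 : ∀ t, a t < 0) (hφ : IsPeriodicSolution (quadField a b) T φ)
    (h0 : (∫ t in (0 : ℝ)..T, a t * φ t) = 0) : IsDouble (quadField a b) T φ := by
  have hev := displacement_eventuallyEq hT.le ha hφ
  have hE : linearFlow a φ T = 1 := weight_eq_one_iff.2 (by simp [h0])
  have haE : Continuous fun s => a s * linearFlow a φ s :=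
    ha.mul (continuous_weight (ha.mul hφ.continuous).neg)
  have hI : (∫ s in (0 : ℝ)..T, a s * linearFlow a φ s) < 0 := by
    have := intervalIntegral.intervalIntegral_pos_of_pos (haE.fun_neg.intervalIntegrable 0 T)
      (fun t => neg_pos.2 (mul_neg_of_neg_of_pos (ha0 t) (weight_pos _ t))) hT
    rwa [intervalIntegral.integral_neg, neg_pos] at this
  rw [hE] at hev
  generalize (∫ s in (0 : ℝ)..T, a s * linearFlow a φ s) = I at hI hev
  have hnear : ∀ᶠ x in 𝓝 (φ 0), 1 - (x - φ 0) * I ≠ 0 :=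
    ContinuousAt.eventually_ne (by fun_prop) (by simp)
  refine ⟨(eventually_isSolutionFrom_add ha hφ).mono fun x hx => ⟨_, hx⟩,
    (contDiffAt_mobius _ _ _ _).congr_of_eventuallyEq hev, fun k hk => ?_, ?_⟩
  · interval_cases k
    · simp [hev.eq_of_nhds]
    · rw [iteratedDeriv_one, hev.deriv_eq, (hasDerivAt_mobius (by simp)).deriv]
      simp
  · have hder : deriv (displacement (quadField a b) T) =ᶠ[𝓝 (φ 0)]
        fun x => 1 / (1 - (x - φ 0) * I) ^ 2 - 1 := by
      filter_upwards [hev.eventuallyEq_nhds, hnear] with x hx hx'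
      rw [hx.deriv_eq, (hasDerivAt_mobius hx').deriv]
    have hd2 : HasDerivAt (fun x => 1 / (1 - (x - φ 0) * I) ^ 2 - 1) (2 * I) (φ 0) := by
      have h := ((((hasDerivAt_id' (φ 0)).sub_const (φ 0)).mul_const I).const_sub 1).fun_pow 2
      refine (((hasDerivAt_const (φ 0) (1 : ℝ)).div h (by simp)).sub_const 1).congr_deriv ?_
      simp
    rw [iteratedDeriv_succ, iteratedDeriv_one, hder.deriv_eq, hd2.deriv]
    exact mul_ne_zero two_ne_zero hI.ne

/-! ### The normal form of the family -/

lemma sin_sub_two_neg (t : ℝ) : Real.sin t - 2 < 0 := by linarith [Real.sin_le_one t]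

/-- The shift `A` of the family. -/
def familyShift (t : ℝ) : ℝ := Real.cos t / (2 * (Real.sin t - 2))

lemma hasDerivAt_sin_sub_two (t : ℝ) : HasDerivAt (fun t => Real.sin t - 2) (Real.cos t) t :=
  (Real.hasDerivAt_sin t).sub_const 2

lemma shift_eq_familyShift : shift (fun t => Real.sin t - 2) (fun _ => 0) = familyShift := by
  funext t
  have := (sin_sub_two_neg t).ne
  rw [shift, (hasDerivAt_sin_sub_two t).deriv, familyShift]
  field_simp
  ring

lemma hasDerivAt_familyShift (t : ℝ) :
    HasDerivAt familyShift ((2 * Real.sin t - 1) / (2 * (Real.sin t - 2) ^ 2)) t := by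
  have h := (sin_sub_two_neg t).ne
  refine ((Real.hasDerivAt_cos t).div ((hasDerivAt_sin_sub_two t).const_mul 2)
    (by positivity)).congr_deriv ?_
  field_simp
  linear_combination (-1) * Real.sin_sq_add_cos_sq t

lemma continuous_familyShift : Continuous familyShift :=
  continuous_iff_continuousAt.2 fun t => (hasDerivAt_familyShift t).continuousAt

lemma continuous_deriv_familyShift :
    Continuous fun t : ℝ => (2 * Real.sin t - 1) / (2 * (Real.sin t - 2) ^ 2) :=
  Continuous.div (by fun_prop) (by fun_prop) fun t => by
    have := (sin_sub_two_neg t).ne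
    positivity

lemma familyShift_periodic : Function.Periodic familyShift (2 * Real.pi) := fun t => by
  simp [familyShift]

lemma familyGamma_eq (η t : ℝ) : familyGamma η t =
    (Real.sin t - 2) * (η - Real.cos t) - familyShift t ^ 2 +
      (2 * Real.sin t - 1) / (2 * (Real.sin t - 2) ^ 2) := by
  rw [familyGamma, reducedGamma, shift_eq_familyShift, (hasDerivAt_familyShift t).deriv]

lemma continuous_familyGamma (η : ℝ) : Continuous (familyGamma η) := by
  have := continuous_familyShift
  have := continuous_deriv_familyShift
  rw [funext (familyGamma_eq η)]
  fun_prop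

lemma familyGamma_periodic (η : ℝ) : Function.Periodic (familyGamma η) (2 * Real.pi) := fun t => by
  simp [familyGamma_eq, familyShift_periodic t]

lemma familyField_eq (η : ℝ) :
    familyField η = quadField (fun t => Real.sin t - 2) (fun t => η - Real.cos t) := by
  funext t u
  simp only [familyField, quadField]
  ring

/-- The change of variables `x = (sin t - 2) u + A`. -/
def toNormal (u : ℝ → ℝ) (t : ℝ) : ℝ := (Real.sin t - 2) * u t + familyShift t

/-- The inverse change of variables. -/
def ofNormal (x : ℝ → ℝ) (t : ℝ) : ℝ := (x t - familyShift t) / (Real.sin t - 2)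

@[simp] lemma toNormal_ofNormal (x : ℝ → ℝ) : toNormal (ofNormal x) = x := by
  funext t
  have := (sin_sub_two_neg t).ne
  simp only [toNormal, ofNormal]
  field_simp
  ring

@[simp] lemma ofNormal_toNormal (u : ℝ → ℝ) : ofNormal (toNormal u) = u := by
  funext t
  have := (sin_sub_two_neg t).ne
  simp only [toNormal, ofNormal]
  field_simp
  ring

/-- The defect of the transformed function. -/
lemma hasDerivAt_toNormal {η t u' : ℝ} {u : ℝ → ℝ} (h : HasDerivAt u u' t) :
    HasDerivAt (toNormal u) (normalField (familyGamma η) t (toNormal u t) +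
      (Real.sin t - 2) * (u' - familyField η t (u t))) t := by
  refine (((hasDerivAt_sin_sub_two t).mul h).add (hasDerivAt_familyShift t)).congr_deriv ?_
  -- This identity is what cancels the terms linear in u.
  have hA : 2 * (Real.sin t - 2) * familyShift t = Real.cos t := by
    have := (sin_sub_two_neg t).ne
    rw [familyShift]
    field_simp
  rw [normalField, familyGamma_eq, toNormal, familyField]
  linear_combination (-u t) * hA

lemma IsPeriodicSolution.toNormal {η : ℝ} {u : ℝ → ℝ}
    (h : IsPeriodicSolution (familyField η) (2 * Real.pi) u) :
    IsPeriodicSolution (normalField (familyGamma η)) (2 * Real.pi) (toNormal u) := by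
  refine ⟨fun t => (hasDerivAt_toNormal (h.1 t)).congr_deriv (by ring), fun t => ?_⟩
  simp [Riccati.toNormal, h.2 t, familyShift_periodic t]

lemma IsPeriodicSolution.ofNormal {η : ℝ} {x : ℝ → ℝ}
    (h : IsPeriodicSolution (normalField (familyGamma η)) (2 * Real.pi) x) :
    IsPeriodicSolution (familyField η) (2 * Real.pi) (ofNormal x) := by
  refine ⟨fun t => ?_, fun t => by simp [Riccati.ofNormal, h.2 t, familyShift_periodic t]⟩
  have hne := (sin_sub_two_neg t).ne
  have hu := ((h.1 t).sub (hasDerivAt_familyShift t)).div (hasDerivAt_sin_sub_two t) hne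
  have e := (hasDerivAt_toNormal (η := η) (u := Riccati.ofNormal x) hu).unique
    ((toNormal_ofNormal x).symm ▸ h.1 t)
  rw [toNormal_ofNormal, add_eq_left, mul_eq_zero] at e
  exact hu.congr_deriv (sub_eq_zero.1 (e.resolve_left hne))

/-- A is the derivative of log(2 - sin t)/2. Hence x and (sin t - 2)u have the same integral, and
the mean of x decides the multiplicity of u. -/
lemma integral_familyShift : ∫ t in (0 : ℝ)..2 * Real.pi, familyShift t = 0 := by
  have h : ∀ t, HasDerivAt (fun t => Real.log (2 - Real.sin t) / 2) (familyShift t) t := fun t => by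
    have hne := (sin_sub_two_neg t).ne
    have hne' : 2 - Real.sin t ≠ 0 := by contrapose! hne; linarith
    refine ((((Real.hasDerivAt_sin t).const_sub 2).log hne').div_const 2).congr_deriv ?_
    rw [familyShift]
    field_simp
    ring
  rw [intervalIntegral.integral_eq_sub_of_hasDerivAt (fun t _ => h t)
    (continuous_familyShift.intervalIntegrable _ _)]
  simp

lemma integral_toNormal {u : ℝ → ℝ} (hu : Continuous u) :
    ∫ t in (0 : ℝ)..2 * Real.pi, toNormal u t =
      ∫ t in (0 : ℝ)..2 * Real.pi, (Real.sin t - 2) * u t := by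
  unfold toNormal
  rw [intervalIntegral.integral_add (Continuous.intervalIntegrable (by fun_prop) _ _)
    (continuous_familyShift.intervalIntegrable _ _), integral_familyShift, add_zero]

/-! ### The discriminant of the family -/

lemma familyGamma_add (η h t : ℝ) :
    familyGamma (η + h) t = familyGamma η t + h * (Real.sin t - 2) := by
  rw [familyGamma_eq, familyGamma_eq]
  ring

lemma isGreatest_familyDiscriminant (η : ℝ) :
    IsGreatest (subsolutionLevels (2 * Real.pi) (familyGamma η)) (familyDiscriminant η) :=
  isGreatest_discriminant Real.two_pi_pos (continuous_familyGamma η) (familyGamma_periodic η)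

/-- The optimal p for η also serves η + h: since sin t - 2 ≤ -1, its level rises by at least h. The
companion upper bound uses sin t - 2 ≥ -3. -/
lemma familyDiscriminant_add_le {η h : ℝ} (hh : 0 ≤ h) :
    familyDiscriminant η + h ≤ familyDiscriminant (η + h) := by
  obtain ⟨p, hp, hsub⟩ := (isGreatest_familyDiscriminant η).1
  refine (isGreatest_familyDiscriminant (η + h)).2 ⟨p, hp, fun t => ?_⟩
  have := hsub t
  rw [familyGamma_add]
  nlinarith [Real.sin_le_one t]

lemma familyDiscriminant_le_add {η h : ℝ} (hh : 0 ≤ h) :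
    familyDiscriminant (η + h) ≤ familyDiscriminant η + 3 * h := by
  obtain ⟨p, hp, hsub⟩ := (isGreatest_familyDiscriminant (η + h)).1
  rw [← sub_le_iff_le_add]
  refine (isGreatest_familyDiscriminant η).2 ⟨p, hp, fun t => ?_⟩
  have := hsub t
  rw [familyGamma_add] at this
  nlinarith [Real.neg_one_le_sin t]

lemma strictMono_familyDiscriminant : StrictMono familyDiscriminant := fun x y hxy => by
  have := familyDiscriminant_add_le (η := x) (sub_pos.2 hxy).le
  rw [add_sub_cancel] at this
  linarith

lemma continuous_familyDiscriminant : Continuous familyDiscriminant := by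
  refine (LipschitzWith.of_le_add_mul 3 fun x y => ?_).continuous
  rcases le_total x y with h | h
  · have := strictMono_familyDiscriminant.monotone h
    have : 0 ≤ ((3 : NNReal) : ℝ) * dist x y := by positivity
    linarith
  · have := familyDiscriminant_le_add (η := y) (sub_nonneg.2 h)
    rw [add_sub_cancel] at this
    rwa [Real.dist_eq, abs_of_nonneg (sub_nonneg.2 h)]

/-- The test function u = -sin t / 4 has defect u' - f ≤ -1/4, with equality at t = 0; multiplying
by sin t - 2 ≤ -1 gives a subsolution of level 1/4. -/
lemma familyDiscriminant_one_pos : 0 < familyDiscriminant 1 := by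
  have hu : ∀ t, HasDerivAt (fun t => -Real.sin t / 4) (-Real.cos t / 4) t := fun t =>
    (Real.hasDerivAt_sin t).neg.div_const 4
  have hp := fun t => hasDerivAt_toNormal (η := 1) (hu t)
  have hcont := continuous_familyGamma 1
  have hsc := continuous_familyShift
  have hmem : (1 / 4 : ℝ) ∈ subsolutionLevels (2 * Real.pi) (familyGamma 1) := by
    refine ⟨_, mem_periodicC1_of_hasDerivAt hp ?_ fun t => ?_, fun t => ?_⟩
    · unfold normalField toNormal familyField
      fun_prop
    · simp [toNormal, familyShift_periodic t]
    · rw [(hp t).deriv, normalField, familyField]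
      have h1 : (1 / 4 : ℝ) ≤ (Real.sin t - 2) * (-Real.sin t / 4) ^ 2 + 1 - Real.cos t -
          -Real.cos t / 4 := by
        nlinarith [Real.neg_one_le_sin t, Real.sin_sq_add_cos_sq t, Real.cos_le_one t,
          sq_nonneg (Real.sin t), sq_nonneg (1 - Real.cos t),
          mul_nonneg (sq_nonneg (Real.sin t)) (neg_le_iff_add_nonneg.1 (Real.neg_one_le_sin t))]
      nlinarith [Real.sin_le_one t]
  have := (isGreatest_familyDiscriminant 1).2 hmem
  linarith

/-- The integral of `A ^ 2`. -/
lemma integral_familyShift_sq :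
    ∫ t in (0 : ℝ)..2 * Real.pi, familyShift t ^ 2 =
      2 * Real.pi * ((2 * Real.sqrt 3 - 3) / 12) := by
  have h3 : Real.sqrt 3 ^ 2 = 3 := Real.sq_sqrt (by norm_num)
  have h3pos : 0 < Real.sqrt 3 := Real.sqrt_pos.2 (by norm_num)
  have h3gt : 1 < Real.sqrt 3 := by nlinarith
  have h3lt : Real.sqrt 3 < 2 := by nlinarith
  set r := Real.sqrt 3
  -- With ρ = 2 - √3, a root of ρ² - 4ρ + 1, this is the argument of 1 - iρe^{-it}. As ρ < 1 its
  -- real part stays positive, so the primitive is smooth on the whole period, unlike the one from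
  -- tan(t/2).
  have harc : ∀ t, HasDerivAt
      (fun t => Real.arctan (-((2 - r) * Real.cos t) / (1 - (2 - r) * Real.sin t)))
      ((Real.sin t - (2 - r)) / (2 * (2 - Real.sin t))) t := fun t => by
    have hM : 0 < 1 - (2 - r) * Real.sin t := by nlinarith [Real.sin_le_one t]
    have hs : 0 < 2 - Real.sin t := by linarith [sin_sub_two_neg t]
    refine ((((Real.hasDerivAt_cos t).const_mul (2 - r)).fun_neg.fun_div
      (((Real.hasDerivAt_sin t).const_mul (2 - r)).const_sub 1) hM.ne').arctan).congr_deriv ?_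
    have hden : (1 - (2 - r) * Real.sin t) ^ 2 + ((2 - r) * Real.cos t) ^ 2 =
        2 * (2 - r) * (2 - Real.sin t) := by
      linear_combination (2 - r) ^ 2 * Real.sin_sq_add_cos_sq t + h3
    have hnum : (2 - r) * Real.sin t * (1 - (2 - r) * Real.sin t) - ((2 - r) * Real.cos t) ^ 2 =
        (2 - r) * (Real.sin t - (2 - r)) := by
      linear_combination (-(2 - r) ^ 2) * Real.sin_sq_add_cos_sq t
    have hden0 : 0 < (1 - (2 - r) * Real.sin t) ^ 2 + ((2 - r) * Real.cos t) ^ 2 := by positivity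
    have e : ∀ M N P : ℝ, 0 < M → 0 < M ^ 2 + N ^ 2 →
        1 / (1 + (-N / M) ^ 2) * ((P * M - N ^ 2) / M ^ 2) =
          (P * M - N ^ 2) / (M ^ 2 + N ^ 2) := fun M N P hM hMN => by
      field_simp
    have h2r : 0 < 2 - r := by linarith
    have := e _ ((2 - r) * Real.cos t) ((2 - r) * Real.sin t) hM hden0
    rw [hden, hnum] at this
    calc _ = _ := by congr 2; linear_combination hnum
      _ = _ := this
      _ = _ := by field_simp
  -- Integration by parts gives cos²/(2 - sin)² = (cos/(2 - sin))' + 2/(2 - sin) - 1; only the terms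
  -- linear in t contribute over a period.
  have hH : ∀ t, HasDerivAt (fun t => (1 / 4) * (Real.cos t / (2 - Real.sin t) - t +
      2 * ((1 / r) * (t + 2 * Real.arctan
        (-((2 - r) * Real.cos t) / (1 - (2 - r) * Real.sin t)))))) (familyShift t ^ 2) t :=
    fun t => by
    have hs : 0 < 2 - Real.sin t := by linarith [sin_sub_two_neg t]
    have hs' := (sin_sub_two_neg t).ne
    refine (((((Real.hasDerivAt_cos t).div ((Real.hasDerivAt_sin t).const_sub 2) hs.ne').sub
      (hasDerivAt_id' t)).add ((((hasDerivAt_id' t).add ((harc t).const_mul 2)).const_mul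
        (1 / r)).const_mul 2)).const_mul (1 / 4)).congr_deriv ?_
    rw [familyShift, show Real.sin t - 2 = -(2 - Real.sin t) by ring]
    field_simp
    ring
  rw [intervalIntegral.integral_eq_sub_of_hasDerivAt (fun t _ => hH t)
    ((continuous_familyShift.pow 2).intervalIntegrable _ _)]
  simp only [Real.cos_two_pi, Real.sin_two_pi, Real.cos_zero, Real.sin_zero]
  field_simp
  linear_combination (-32 * Real.pi) * h3

lemma integral_familyGamma (η : ℝ) : ∫ t in (0 : ℝ)..2 * Real.pi, familyGamma η t =
    2 * Real.pi * ((3 - 2 * Real.sqrt 3) / 12 - 2 * η) := by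
  -- Adding A² back leaves an elementary primitive.
  have h1 : ∀ t, HasDerivAt (fun t => η * -Real.cos t - Real.sin t ^ 2 / 2 - 2 * η * t +
      2 * Real.sin t + familyShift t) (familyGamma η t + familyShift t ^ 2) t := fun t => by
    refine ((((((Real.hasDerivAt_cos t).fun_neg.const_mul η).sub
      (((Real.hasDerivAt_sin t).fun_pow 2).div_const 2)).sub
      ((hasDerivAt_id' t).const_mul (2 * η))).add ((Real.hasDerivAt_sin t).const_mul 2)).add
      (hasDerivAt_familyShift t)).congr_deriv ?_
    rw [familyGamma_eq]
    ring
  have hg := continuous_familyGamma η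
  have hs := continuous_familyShift
  have h2 := intervalIntegral.integral_eq_sub_of_hasDerivAt (a := 0) (b := 2 * Real.pi)
    (fun t _ => h1 t) (Continuous.intervalIntegrable (by fun_prop) _ _)
  rw [intervalIntegral.integral_add (hg.intervalIntegrable _ _)
    (Continuous.intervalIntegrable (by fun_prop) _ _), integral_familyShift_sq] at h2
  simp only [familyShift, Real.cos_two_pi, Real.sin_two_pi, Real.cos_zero, Real.sin_zero] at h2
  linear_combination h2

/-- At this η the average of γ is zero, so integrating the equation at level D gives ∫φ² = -2πD. If
D ≥ 0 then φ = 0 and γ is constant, which it is not. -/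
lemma familyDiscriminant_neg : familyDiscriminant ((3 - 2 * Real.sqrt 3) / 24) < 0 := by
  set η := (3 - 2 * Real.sqrt 3) / 24 with hη
  have hg := continuous_familyGamma η
  obtain ⟨φ, hφ, -⟩ := exists_isPeriodicSolution_discriminant Real.two_pi_pos hg
    (familyGamma_periodic η)
  have hφc := hφ.continuous
  set D := discriminant (2 * Real.pi) (familyGamma η)
  change D < 0
  have hint : (∫ t in (0 : ℝ)..2 * Real.pi, φ t ^ 2) + 2 * Real.pi * D = 0 := by
    have h := intervalIntegral.integral_eq_sub_of_hasDerivAt (a := 0) (b := 2 * Real.pi)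
      (fun t _ => hφ.1 t)
      ((continuous_normalField (hg.add continuous_const) hφc).intervalIntegrable _ _)
    simp only [normalField] at h
    rw [intervalIntegral.integral_add (Continuous.intervalIntegrable (by fun_prop) _ _)
      (Continuous.intervalIntegrable (by fun_prop) _ _),
      intervalIntegral.integral_add (Continuous.intervalIntegrable (by fun_prop) _ _)
      (Continuous.intervalIntegrable (by fun_prop) _ _), integral_familyGamma,
      intervalIntegral.integral_const, hφ.apply_period, smul_eq_mul] at h
    rw [hη] at h
    linear_combination h
  by_contra! hD
  have hzero : ∫ t in (0 : ℝ)..2 * Real.pi, φ t ^ 2 = 0 := by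
    have := intervalIntegral.integral_nonneg Real.two_pi_pos.le
      (fun t _ => sq_nonneg (φ t)) (μ := MeasureTheory.volume)
    have := mul_nonneg Real.two_pi_pos.le hD
    linarith
  have hφ0 : ∀ t ∈ Ico 0 (2 * Real.pi), φ t = 0 := by
    by_contra! hcon
    obtain ⟨t, ht, hne⟩ := hcon
    have := intervalIntegral.integral_pos Real.two_pi_pos (hφc.pow 2).continuousOn
      (fun t _ => sq_nonneg (φ t)) ⟨t, Ico_subset_Icc_self ht, sq_pos_of_ne_zero hne⟩
    exact this.ne' hzero
  have hφz : φ = fun _ => 0 := funext fun t => by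
    obtain ⟨s, hs, e⟩ := hφ.2.exists_mem_Ico₀ Real.two_pi_pos t
    rw [e, hφ0 s hs]
  have hγ : ∀ t, familyGamma η t + D = 0 := fun t => by
    have h := hφ.1 t
    simp only [hφz, normalField] at h
    simpa using h.unique (hasDerivAt_const t 0)
  -- The values of γ at 0 and π differ by 4.
  have e1 := hγ 0
  have e2 := hγ Real.pi
  simp only [familyGamma_eq, familyShift, Real.cos_zero, Real.sin_zero, Real.cos_pi,
    Real.sin_pi] at e1 e2
  norm_num at e1 e2
  linarith

/-! ### Periodic solutions of the family -/

lemma isPeriodicSolution_add_discriminant_iff {η : ℝ} {x : ℝ → ℝ} (h : familyDiscriminant η = 0) :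
    IsPeriodicSolution (normalField fun t => familyGamma η t +
      discriminant (2 * Real.pi) (familyGamma η)) (2 * Real.pi) x ↔
    IsPeriodicSolution (normalField (familyGamma η)) (2 * Real.pi) x := by
  rw [show discriminant (2 * Real.pi) (familyGamma η) = 0 from h]
  simp only [add_zero]

/-- A periodic solution in normal form is itself a subsolution of level 0. -/
lemma familyDiscriminant_nonneg_of_isPeriodicSolution {η : ℝ} {u : ℝ → ℝ}
    (h : IsPeriodicSolution (familyField η) (2 * Real.pi) u) : 0 ≤ familyDiscriminant η := by
  have hx := h.toNormal
  refine (isGreatest_familyDiscriminant η).2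
    ⟨_, hx.mem_periodicC1 (continuous_familyGamma η), fun t => ?_⟩
  rw [(hx.1 t).deriv, normalField, add_zero]

lemma integral_mul_ofNormal {x : ℝ → ℝ} {η : ℝ}
    (h : IsPeriodicSolution (normalField (familyGamma η)) (2 * Real.pi) x) :
    ∫ t in (0 : ℝ)..2 * Real.pi, (Real.sin t - 2) * ofNormal x t =
      ∫ t in (0 : ℝ)..2 * Real.pi, x t := by
  rw [← integral_toNormal h.ofNormal.continuous, toNormal_ofNormal]

lemma isHyperbolic_ofNormal {x : ℝ → ℝ} {η : ℝ}
    (h : IsPeriodicSolution (normalField (familyGamma η)) (2 * Real.pi) x)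
    (hne : (∫ t in (0 : ℝ)..2 * Real.pi, x t) ≠ 0) :
    IsHyperbolic (familyField η) (2 * Real.pi) (ofNormal x) := by
  have hu := h.ofNormal
  rw [← integral_mul_ofNormal h] at hne
  rw [familyField_eq] at hu ⊢
  exact isHyperbolic_quadField Real.two_pi_pos.le (by fun_prop) hu hne

lemma isDouble_ofNormal {x : ℝ → ℝ} {η : ℝ}
    (h : IsPeriodicSolution (normalField (familyGamma η)) (2 * Real.pi) x)
    (h0 : (∫ t in (0 : ℝ)..2 * Real.pi, x t) = 0) :
    IsDouble (familyField η) (2 * Real.pi) (ofNormal x) := by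
  have hu := h.ofNormal
  rw [← integral_mul_ofNormal h] at h0
  rw [familyField_eq] at hu ⊢
  exact isDouble_quadField Real.two_pi_pos (by fun_prop) sin_sub_two_neg hu h0

theorem exists_unique_isDouble_of_familyDiscriminant_eq_zero {η : ℝ}
    (h : familyDiscriminant η = 0) :
    ∃ φ, IsPeriodicSolution (familyField η) (2 * Real.pi) φ ∧
      IsDouble (familyField η) (2 * Real.pi) φ ∧
      ∀ ψ, IsPeriodicSolution (familyField η) (2 * Real.pi) ψ → ψ = φ := by
  obtain ⟨x, hx, hx0⟩ := exists_isPeriodicSolution_discriminant Real.two_pi_pos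
    (continuous_familyGamma η) (familyGamma_periodic η)
  rw [isPeriodicSolution_add_discriminant_iff h] at hx
  refine ⟨ofNormal x, hx.ofNormal, isDouble_ofNormal hx hx0, fun ψ hψ => ?_⟩
  rw [← eq_of_isPeriodicSolution_of_zeroMean Real.two_pi_pos hx hx0 hψ.toNormal,
    ofNormal_toNormal]

theorem exists_exactly_two_isHyperbolic_of_familyDiscriminant_pos {η : ℝ}
    (h : 0 < familyDiscriminant η) :
    ∃ φ₁ φ₂, φ₁ ≠ φ₂ ∧
      IsPeriodicSolution (familyField η) (2 * Real.pi) φ₁ ∧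
      IsPeriodicSolution (familyField η) (2 * Real.pi) φ₂ ∧
      IsHyperbolic (familyField η) (2 * Real.pi) φ₁ ∧
      IsHyperbolic (familyField η) (2 * Real.pi) φ₂ ∧
      ∀ ψ, IsPeriodicSolution (familyField η) (2 * Real.pi) ψ → ψ = φ₁ ∨ ψ = φ₂ := by
  obtain ⟨x₁, x₂, hne, h₁, h₂, n₁, n₂, hall⟩ := exists_exactly_two_isPeriodicSolution
    Real.two_pi_pos (continuous_familyGamma η) (familyGamma_periodic η)
    (isGreatest_familyDiscriminant η).1 h
  refine ⟨ofNormal x₁, ofNormal x₂, fun e => hne ?_, h₁.ofNormal, h₂.ofNormal,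
    isHyperbolic_ofNormal h₁ n₁, isHyperbolic_ofNormal h₂ n₂, fun ψ hψ => ?_⟩
  · rw [← toNormal_ofNormal x₁, e, toNormal_ofNormal]
  · rw [← ofNormal_toNormal ψ]
    exact (hall _ hψ.toNormal).imp (congrArg ofNormal) (congrArg ofNormal)

end Riccati

end

theorem mainTheorem5 :
    -- the number `γ*` in the discriminant is both the stated maximum and the stated minimum
    (∀ η : ℝ,
      IsGreatest
        (Riccati.lowerMu (2 * Real.pi) (Riccati.familyGamma η) ''
          Riccati.periodicC1 (2 * Real.pi))
        (Riccati.gammaStar (2 * Real.pi) (Riccati.familyGamma η)) ∧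
      IsLeast
        (Riccati.upperMu (2 * Real.pi) (Riccati.familyGamma η) ''
          Riccati.periodicC1Zero (2 * Real.pi))
        (Riccati.gammaStar (2 * Real.pi) (Riccati.familyGamma η))) ∧
    ∃ ηs : ℝ, ηs ∈ Set.Ioo ((3 - 2 * Real.sqrt 3) / 24) 1 ∧
      (∀ η : ℝ, Riccati.familyDiscriminant η = 0 ↔ η = ηs) ∧
      (∀ η : ℝ, η < ηs → Riccati.familyDiscriminant η < 0) ∧
      (∀ η : ℝ, ηs < η → 0 < Riccati.familyDiscriminant η) ∧
      -- below `ηs` there are no periodic solutions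
      (∀ η : ℝ, η < ηs →
        ¬ ∃ φ, Riccati.IsPeriodicSolution (Riccati.familyField η) (2 * Real.pi) φ) ∧
      -- at `ηs` there is exactly one periodic solution, and it is double
      (∃ φ, Riccati.IsPeriodicSolution (Riccati.familyField ηs) (2 * Real.pi) φ ∧
        Riccati.IsDouble (Riccati.familyField ηs) (2 * Real.pi) φ ∧
        ∀ ψ, Riccati.IsPeriodicSolution (Riccati.familyField ηs) (2 * Real.pi) ψ → ψ = φ) ∧
      -- above `ηs` there are exactly two periodic solutions, and they are hyperbolic
      (∀ η : ℝ, ηs < η →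
        ∃ φ₁ φ₂, φ₁ ≠ φ₂ ∧
          Riccati.IsPeriodicSolution (Riccati.familyField η) (2 * Real.pi) φ₁ ∧
          Riccati.IsPeriodicSolution (Riccati.familyField η) (2 * Real.pi) φ₂ ∧
          Riccati.IsHyperbolic (Riccati.familyField η) (2 * Real.pi) φ₁ ∧
          Riccati.IsHyperbolic (Riccati.familyField η) (2 * Real.pi) φ₂ ∧
          ∀ ψ, Riccati.IsPeriodicSolution (Riccati.familyField η) (2 * Real.pi) ψ →
            ψ = φ₁ ∨ ψ = φ₂) := by
  refine ⟨fun η => Riccati.gammaStar_isGreatest_isLeast Real.two_pi_pos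
    (Riccati.continuous_familyGamma η) (Riccati.familyGamma_periodic η), ?_⟩
  have hmono := Riccati.strictMono_familyDiscriminant
  have hlt : (3 - 2 * Real.sqrt 3) / 24 < 1 := by linarith [Real.sqrt_nonneg 3]
  obtain ⟨ηs, hmem, h0⟩ := intermediate_value_Ioo hlt.le
    Riccati.continuous_familyDiscriminant.continuousOn
    ⟨Riccati.familyDiscriminant_neg, Riccati.familyDiscriminant_one_pos⟩
  have hneg : ∀ η, η < ηs → Riccati.familyDiscriminant η < 0 := fun η h => h0 ▸ hmono h
  have hpos : ∀ η, ηs < η → 0 < Riccati.familyDiscriminant η := fun η h => h0 ▸ hmono h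
  refine ⟨ηs, hmem, fun η => ⟨fun h => hmono.injective (h.trans h0.symm), fun h => h ▸ h0⟩,
    hneg, hpos, ?_, Riccati.exists_unique_isDouble_of_familyDiscriminant_eq_zero h0,
    fun η h => Riccati.exists_exactly_two_isHyperbolic_of_familyDiscriminant_pos (hpos η h)⟩
  rintro η h ⟨φ, hφ⟩
  exact (Riccati.familyDiscriminant_nonneg_of_isPeriodicSolution hφ).not_gt (hneg η h)
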